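/- Fix an inverse temperature $\beta>0$. For $N\ge 1$ let the Sherrington–Kirkpatrick (SK) model on the Nishimori line be $\mathcal H_N^{\mathrm{SK}}=-\frac{1}{\sqrt{2N}}\sum_{1\le i\ne j\le N}J_{i,j}\sigma_i\sigma_j$, $\sigma_i=\pm1$, where the $J_{i,j}$ (one for every ordered pair) are independent Gaussian variables with mean $\beta/\sqrt{2N}$ and variance $1$, and let $Z_N^{\mathrm{SK}}=\sum_{\sigma}e^{-\beta\mathcal H_N^{\mathrm{SK}}}$. Then the limit $$f^{\mathrm{SK}}(\beta)=-\lim_{N\to\infty}\frac{1}{\beta N}\,\mathbb E\big[\log Z_N^{\mathrm{SK}}\big]$$ exists. Moreover, let $d\ge1$, let $\Lambda$ be the hypercube of side $L$ in $\mathbb Z^d$ with periodic boundary conditions, $r_{i,j}$ the relative position of the sites $i,j\in\Lambda$ (coordinates reduced modulo $L$ to $[-L/2,L/2)$), and $K(r,\gamma)\propto\gamma^d\phi(\gamma r)$ a Kac potential with $\phi:\mathbb R^d\to[0,\infty)$, normalized by $\sum_{r}K(r,\gamma)=1$ where $r$ runs over the $L^d$ relative positions; it is assumed that with $\gamma=1/L$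 this normalization is possible, i.e. $\sum_r\phi(\gamma r)\neq0$, for all large $L$. Let $\mathcal H_L^{(\gamma)}=-\sum_{i,j\in\Lambda}\sqrt{K(r_{i,j},\gamma)/2}\,J_{i,j}^{(\gamma)}\sigma_i\sigma_j$, where the $J^{(\gamma)}_{i,j}$ (one for every ordered pair) are independent Gaussian variables with mean $\beta\sqrt{K(r_{i,j},\gamma)/2}$ and variance $1$ (the Nishimori line), and $Z_L^{(\gamma)}=\sum_\sigma e^{-\beta\mathcal H_L^{(\gamma)}}$. If the limit $$f(\beta)=-\lim_{L\to\infty,\ \gamma L=1}\frac{1}{\beta L^d}\,\mathbb E\big[\log Z_L^{(\gamma)}\big]$$ exists, then $f(\beta)\le f^{\mathrm{SK}}(\beta)$. -/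

import Mathlib

open MeasureTheory ProbabilityTheory Filter Topology

noncomputable section

/-! Ising spins take values in `ℤˣ = {1, -1}`. -/

/-- The numerical value `±1` of an Ising spin. -/
def spinVal (s : ℤˣ) : ℝ := ((s : ℤ) : ℝ)

/-- The partition function `∑_σ exp (-β H(σ))` over all Ising configurations on the finite site
set `S`. -/
def partitionFn {S : Type*} [Fintype S] [DecidableEq S] (β : ℝ) (H : (S → ℤˣ) → ℝ) : ℝ :=
  ∑ σ : S → ℤˣ, Real.exp (-β * H σ)

/-- The joint law of couplings `J i j`, one for every ordered pair `(i, j)`, that are independent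
Gaussians with mean `mean i j` and variance one. -/
def couplingLaw {S : Type*} [Fintype S] (mean : S → S → ℝ) : Measure (S × S → ℝ) :=
  Measure.pi fun p => gaussianReal (mean p.1 p.2) 1

/-! ### The Kac model -/

/-- The sites of the hypercube of side `L` in `ℤ^d`. -/
abbrev Site (d L : ℕ) : Type := Fin d → Fin L

/-- The representative of `v ∈ ℤ^d` modulo `L ℤ^d` with all coordinates in `[-L/2, L/2)`. -/
def minImage {d : ℕ} (L : ℕ) (v : Fin d → ℤ) : EuclideanSpace ℝ (Fin d) :=
  WithLp.toLp 2 fun k => ((v k).bmod L : ℝ)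

/-- The relative position `r_{ij}` of two sites under periodic boundary conditions. -/
def relPos {d L : ℕ} (i j : Site d L) : EuclideanSpace ℝ (Fin d) :=
  minImage L fun k => (i k : ℤ) - (j k : ℤ)

/-- The sum of `γ^d φ(γ r)` over all `L^d` relative positions `r` of the periodic box. -/
def kacSum {d : ℕ} (φ : EuclideanSpace ℝ (Fin d) → ℝ) (L : ℕ) (γ : ℝ) : ℝ :=
  ∑ i : Site d L, γ ^ d * φ (γ • minImage L fun k => (i k : ℤ))

/-- The Kac potential `K(r, γ)`: proportional to `γ^d φ(γ r)`, and normalized so that its sum over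
the `L^d` relative positions of the periodic box is one (when `kacSum φ L γ ≠ 0`). -/
def kacPotential {d : ℕ} (φ : EuclideanSpace ℝ (Fin d) → ℝ) (L : ℕ) (γ : ℝ)
    (r : EuclideanSpace ℝ (Fin d)) : ℝ :=
  γ ^ d * φ (γ • r) / kacSum φ L γ

/-- The Hamiltonian `-∑_{i,j} √(K(r_{ij}, γ)/2) J_{ij} σ_i σ_j` of the Kac model. -/
def kacHamiltonian {d : ℕ} (φ : EuclideanSpace ℝ (Fin d) → ℝ) (L : ℕ) (γ : ℝ)
    (J : Site d L × Site d L → ℝ) (σ : Site d L → ℤˣ) : ℝ :=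
  -∑ i : Site d L, ∑ j : Site d L,
    √(kacPotential φ L γ (relPos i j) / 2) * J (i, j) * spinVal (σ i) * spinVal (σ j)

/-- The law of the couplings of the Kac model on the Nishimori line. -/
def kacNishimoriLaw {d : ℕ} (φ : EuclideanSpace ℝ (Fin d) → ℝ) (L : ℕ) (γ β : ℝ) :
    Measure (Site d L × Site d L → ℝ) :=
  couplingLaw fun i j => β * √(kacPotential φ L γ (relPos i j) / 2)

/-- The quenched free energy per site of the Kac model in the box of side `L`, on the Nishimori
line. -/
def kacFreeEnergy {d : ℕ} (φ : EuclideanSpace ℝ (Fin d) → ℝ) (L : ℕ) (γ β : ℝ) : ℝ :=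
  -(1 / (β * (L : ℝ) ^ d)) *
    ∫ J, Real.log (partitionFn β (kacHamiltonian φ L γ J)) ∂(kacNishimoriLaw φ L γ β)

/-! ### The Sherrington–Kirkpatrick model -/

/-- The Hamiltonian `-(2N)^{-1/2} ∑_{i ≠ j} J_{ij} σ_i σ_j` of the Sherrington–Kirkpatrick model
with `N` spins. -/
def skHamiltonian (N : ℕ) (J : Fin N × Fin N → ℝ) (σ : Fin N → ℤˣ) : ℝ :=
  -(1 / √(2 * (N : ℝ))) *
    ∑ i : Fin N, ∑ j : Fin N,
      if i ≠ j then J (i, j) * spinVal (σ i) * spinVal (σ j) else 0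

/-- The law of the couplings of the Sherrington–Kirkpatrick model on the Nishimori line. -/
def skNishimoriLaw (N : ℕ) (β : ℝ) : Measure (Fin N × Fin N → ℝ) :=
  couplingLaw fun _ _ => β / √(2 * (N : ℝ))

/-- The quenched free energy per spin of the Sherrington–Kirkpatrick model with `N` spins, on the
Nishimori line. -/
def skFreeEnergy (N : ℕ) (β : ℝ) : ℝ :=
  -(1 / (β * (N : ℝ))) *
    ∫ J, Real.log (partitionFn β (skHamiltonian N J)) ∂(skNishimoriLaw N β)

end

open MeasureTheory ProbabilityTheory Filter Topology

noncomputable section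

/-! On the Nishimori line a coupling enters the Gibbs weight as a Gaussian field whose mean and
variance are both a number `t p ≥ 0`, so either model is determined by a strength vector `t` and its
free entropy Ψ(t) = E log Z. The core of the proof is that Ψ is convex on the orthant of nonnegative
strengths.

Write m_p for the Gibbs average of `x p` and C_pq for the Gibbs covariance. Differentiating in `t`
and integrating by parts, the gradient of Ψ is E[m_p + (1 - m_p²)/2]. A second differentiation gives
an observable with no evident sign. Gauge symmetry (`integral_gaussField_nonneg`) allows it to be
averaged over sign changes of the field weighted by the Gibbs weight, and the quadratic form becomes
half of the sum of a_p a_q C_pq² times Z. This is nonnegative, since the entrywise square of a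
covariance matrix is positive semidefinite (`sum_gibbsCov_sq_nonneg`).

Convexity places Ψ above its tangent at a uniform strength vector (`freeEntropy_tangent_le`). There
all off-diagonal partial derivatives agree by permutation symmetry, so a perturbation with total
zero has no first-order effect apart from a diagonal error. Hence for a fixed total strength the
uniform model minimizes Ψ up to β² (`meanFieldEntropy_le`).

This one inequality is used twice. Against two decoupled mean-field blocks it gives subadditivity up
to β², and Fekete's lemma yields the SK limit. Against the Kac couplings, whose rows sum to one and
whose total strength is therefore the mean-field one, it gives the bound on the Kac free energy. The
β² errors and the diagonal terms absent from SK are O(1) and vanish per site. -/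

/-! ### Gaussian product measures -/

/-- The law of a family of independent standard Gaussian variables. -/
abbrev iidGaussian (P : Type*) [Fintype P] : Measure (P → ℝ) :=
  Measure.pi fun _ => gaussianReal 0 1

theorem hasDerivAt_gaussianPDFReal_zero_one (y : ℝ) :
    HasDerivAt (gaussianPDFReal 0 1) (-(y * gaussianPDFReal 0 1 y)) y := by
  have h1 : HasDerivAt (fun x : ℝ => -(x - 0) ^ 2 / (2 * ((1 : NNReal) : ℝ))) (-y) y := by
    have := ((hasDerivAt_pow 2 y).neg.div_const 2)
    refine (this.congr_deriv (by push_cast; ring)).congr_of_eventuallyEq (Eventually.of_forall fun x => ?_)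
    simp
  have h2 := (h1.exp).const_mul ((√(2 * Real.pi * ((1 : NNReal) : ℝ)))⁻¹)
  refine h2.congr_deriv ?_
  rw [gaussianPDFReal]
  ring

/-- Gaussian integration by parts on the line. -/
theorem integral_id_mul_gaussianReal {f f' : ℝ → ℝ} {B : ℝ} (hf : ∀ y, HasDerivAt f (f' y) y)
    (hf'c : Continuous f') (hB : ∀ y, |f y| ≤ B) (hB' : ∀ y, |f' y| ≤ B) :
    ∫ y, y * f y ∂gaussianReal 0 1 = ∫ y, f' y ∂gaussianReal 0 1 := by
  have hfc : Continuous f := continuous_iff_continuousAt.2 fun y => (hf y).continuousAt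
  have hid : Integrable (fun y : ℝ => y * gaussianPDFReal 0 1 y) := by
    have h : Integrable (fun y : ℝ => y) (gaussianReal 0 1) :=
      (memLp_id_gaussianReal (μ := 0) (v := 1) 1).integrable (by simp)
    rw [gaussianReal_of_var_ne_zero 0 one_ne_zero, integrable_withDensity_iff
      (measurable_gaussianPDF 0 1) (ae_of_all _ fun _ => gaussianPDF_lt_top)] at h
    simpa [toReal_gaussianPDF] using h
  have hpdf := integrable_gaussianPDFReal 0 1
  have hbd : ∀ {k : ℝ → ℝ} {w : ℝ → ℝ}, Continuous k → (∀ y, |k y| ≤ B) → Integrable w →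
      Integrable (k * w) := by
    intro k w hk hkB hw
    exact hw.bdd_mul hk.aestronglyMeasurable (ae_of_all _ hkB)
  rw [integral_gaussianReal_eq_integral_smul one_ne_zero,
    integral_gaussianReal_eq_integral_smul one_ne_zero]
  -- The standard Gaussian density v satisfies v' = -y v, so the factor y is absorbed by ordinary
  -- integration by parts.
  have key := integral_mul_deriv_eq_deriv_mul_of_integrable (u := f) (u' := f')
    (v := gaussianPDFReal 0 1) (v' := fun y => -(y * gaussianPDFReal 0 1 y))
    (fun x _ => hf x) (fun x _ => hasDerivAt_gaussianPDFReal_zero_one x)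
    (hbd hfc hB hid.neg) (hbd hf'c hB' hpdf) (hbd hfc hB hpdf)
  calc ∫ y, gaussianPDFReal 0 1 y • (y * f y)
      = -∫ y, f y * -(y * gaussianPDFReal 0 1 y) := by
        rw [← integral_neg]; congr 1; funext y; simp only [smul_eq_mul]; ring
    _ = ∫ y, f' y * gaussianPDFReal 0 1 y := by rw [key, neg_neg]
    _ = _ := by congr 1; funext y; simp only [smul_eq_mul]; ring

section

variable {P : Type*} [Fintype P]

/-- Resampling one coordinate of a product measure preserves it. -/
theorem measurePreserving_update [DecidableEq P] (μ : P → Measure ℝ)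
    [∀ p, IsProbabilityMeasure (μ p)] (p : P) :
    MeasurePreserving (fun z : (P → ℝ) × ℝ => Function.update z.1 p z.2)
      ((Measure.pi μ).prod (μ p)) (Measure.pi μ) := by
  have hm : Measurable (fun z : (P → ℝ) × ℝ => Function.update z.1 p z.2) := by
    refine measurable_pi_iff.2 fun q => ?_
    by_cases h : q = p
    · subst h; simpa using measurable_snd
    · simpa [Function.update_of_ne h] using! (measurable_pi_apply q).comp measurable_fst
  refine ⟨hm, (Measure.pi_eq fun s hs => ?_).symm⟩
  rw [Measure.map_apply hm (MeasurableSet.univ_pi hs)]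
  have : (fun z : (P → ℝ) × ℝ => Function.update z.1 p z.2) ⁻¹' (Set.univ.pi s) =
      (Set.univ.pi (Function.update s p Set.univ)) ×ˢ (s p) := by
    ext z
    simp only [Set.mem_preimage, Set.mem_pi, Set.mem_univ, true_implies, Set.mem_prod]
    constructor
    · refine fun h => ⟨fun q => ?_, by simpa using h p⟩
      by_cases hq : q = p
      · subst hq; simp
      · simpa [Function.update_of_ne hq] using h q
    · rintro ⟨h1, h2⟩ q
      by_cases hq : q = p
      · subst hq; simpa using h2
      · simpa [Function.update_of_ne hq] using h1 q
  rw [this, Measure.prod_prod, Measure.pi_pi,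
    ← Finset.prod_erase_mul _ _ (Finset.mem_univ p), ← Finset.prod_erase_mul _ _ (Finset.mem_univ p)]
  simp only [Function.update_self, measure_univ, mul_one]
  congr 1
  refine Finset.prod_congr rfl fun q hq => ?_
  rw [Function.update_of_ne (Finset.ne_of_mem_erase hq)]

theorem integrable_coord_iidGaussian (p : P) : Integrable (fun g : P → ℝ => g p) (iidGaussian P) :=
  ((measurePreserving_eval (fun _ : P => gaussianReal 0 1) p).integrable_comp
    measurable_id.aestronglyMeasurable).2
    ((memLp_id_gaussianReal (μ := 0) (v := 1) 1).integrable (by simp))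

theorem integral_coord_iidGaussian (p : P) : ∫ g, g p ∂iidGaussian P = 0 := by
  have := integral_map (μ := iidGaussian P) (φ := fun g => g p) (f := fun y : ℝ => y)
    (measurable_pi_apply p).aemeasurable measurable_id.aestronglyMeasurable
  rw [(measurePreserving_eval (fun _ : P => gaussianReal 0 1) p).map_eq] at this
  rw [← this, integral_id_gaussianReal]

/-- Gaussian integration by parts in several variables. -/
theorem integral_coord_mul_iidGaussian [DecidableEq P] {F F' : (P → ℝ) → ℝ} {B : ℝ} (p : P)
    (hF : ∀ g y, HasDerivAt (fun y => F (Function.update g p y)) (F' (Function.update g p y)) y)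
    (hFc : Continuous F) (hF'c : Continuous F')
    (hB : ∀ g, |F g| ≤ B) (hB' : ∀ g, |F' g| ≤ B) :
    ∫ g, g p * F g ∂iidGaussian P = ∫ g, F' g ∂iidGaussian P := by
  have mp := measurePreserving_update (fun _ : P => gaussianReal 0 1) p
  have hupd (g : P → ℝ) : Continuous (fun y : ℝ => Function.update g p y) :=
    continuous_const.update p continuous_id
  have i1 : Integrable (fun g : P → ℝ => g p * F g) (iidGaussian P) :=
    (integrable_coord_iidGaussian p).mul_bdd hFc.aestronglyMeasurable (ae_of_all _ hB)
  have i2 : Integrable F' (iidGaussian P) :=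
    Integrable.of_bound hF'c.aestronglyMeasurable B (ae_of_all _ hB')
  -- Resampling the coordinate `p` and applying Fubini reduces the claim to the one-dimensional
  -- formula with the other coordinates frozen.
  have e (G : (P → ℝ) → ℝ) (hG : Integrable G (iidGaussian P)) :
      ∫ g, G g ∂iidGaussian P
        = ∫ g, ∫ y, G (Function.update g p y) ∂gaussianReal 0 1 ∂iidGaussian P := by
    have h1 : Integrable (fun z : (P → ℝ) × ℝ => G (Function.update z.1 p z.2))
        ((iidGaussian P).prod (gaussianReal 0 1)) := mp.integrable_comp_of_integrable hG
    rw [← integral_prod _ h1]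
    have h2 := integral_map (f := G) mp.measurable.aemeasurable (by rw [mp.map_eq]; exact hG.1)
    rwa [mp.map_eq] at h2
  rw [e _ i1, e _ i2]
  congr 1
  funext g
  simp only [Function.update_self]
  exact integral_id_mul_gaussianReal (hF g) (hF'c.comp (hupd g)) (fun y => hB _) (fun y => hB' _)

/-- On a box the indicator times the density is a product of functions of independent coordinates,
so its integral factorizes. Needed to pass from the one-dimensional shift density to the
Cameron–Martin formula. -/
theorem pi_withDensity_eq {μ : P → Measure ℝ} [∀ p, IsProbabilityMeasure (μ p)]
    {f : P → ℝ → ENNReal} (hf : ∀ p, Measurable (f p))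
    [∀ p, SigmaFinite ((μ p).withDensity (f p))] :
    Measure.pi (fun p => (μ p).withDensity (f p)) =
      (Measure.pi μ).withDensity (fun g => ∏ p, f p (g p)) := by
  refine Measure.pi_eq fun s hs => ?_
  have hms : MeasurableSet (Set.univ.pi s) := MeasurableSet.univ_pi hs
  rw [withDensity_apply _ hms, ← lintegral_indicator hms]
  have hmi (p : P) : Measurable ((s p).indicator (f p)) := (hf p).indicator (hs p)
  have : (Set.univ.pi s).indicator (fun g : P → ℝ => ∏ p, f p (g p)) =
      fun g => ∏ p, (s p).indicator (f p) (g p) := by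
    funext g
    by_cases h : g ∈ Set.univ.pi s
    · rw [Set.indicator_of_mem h]
      exact Finset.prod_congr rfl fun p _ => (Set.indicator_of_mem (h p trivial) _).symm
    · rw [Set.indicator_of_notMem h]
      simp only [Set.mem_pi, Set.mem_univ, true_implies, not_forall] at h
      obtain ⟨p, hp⟩ := h
      exact (Finset.prod_eq_zero (Finset.mem_univ p) (Set.indicator_of_notMem hp _)).symm
  rw [this, lintegral_prod_eq_prod_lintegral_of_indepFun Finset.univ
    (fun p (g : P → ℝ) => (s p).indicator (f p) (g p))
    (iIndepFun_pi fun p => (hmi p).aemeasurable) (fun p => (hmi p).comp (measurable_pi_apply p))]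
  refine Finset.prod_congr rfl fun p _ => ?_
  rw [withDensity_apply _ (hs p), ← lintegral_indicator (hs p)]
  exact (measurePreserving_eval μ p).lintegral_comp (hmi p)

theorem gaussianReal_eq_withDensity (m : ℝ) :
    gaussianReal m 1 = (gaussianReal 0 1).withDensity
      (fun y => ENNReal.ofReal (Real.exp (m * y - m ^ 2 / 2))) := by
  rw [gaussianReal_of_var_ne_zero m one_ne_zero, gaussianReal_of_var_ne_zero 0 one_ne_zero,
    ← withDensity_mul _ (measurable_gaussianPDF 0 1) (by fun_prop)]
  congr 1
  funext y
  simp only [Pi.mul_apply, gaussianPDF]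
  rw [← ENNReal.ofReal_mul (gaussianPDFReal_nonneg _ _ _)]
  congr 1
  simp only [gaussianPDFReal, NNReal.coe_one]
  rw [mul_assoc _ (Real.exp _), ← Real.exp_add]
  congr 2
  ring

theorem iidGaussian_map_add (m : P → ℝ) :
    (iidGaussian P).map (fun g p => m p + g p) = Measure.pi fun p => gaussianReal (m p) 1 := by
  have h (p : P) : (gaussianReal 0 1).map (fun y => m p + y) = gaussianReal (m p) 1 := by
    rw [gaussianReal_map_const_add, zero_add]
  have := Measure.pi_map_pi (μ := fun _ : P => gaussianReal 0 1) (f := fun p y => m p + y)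
    (hμ := fun p => by rw [h]; infer_instance) (fun p => by fun_prop)
  simpa only [h] using this

/-- The Cameron–Martin formula for a finite family of independent Gaussians. -/
theorem integral_add_iidGaussian (m : P → ℝ) {G : (P → ℝ) → ℝ} (hG : Measurable G) :
    ∫ g, G (fun p => m p + g p) ∂iidGaussian P =
      ∫ g, Real.exp (∑ p, (m p * g p - m p ^ 2 / 2)) * G g ∂iidGaussian P := by
  have h1 : (Measure.pi fun p => gaussianReal (m p) 1) = (iidGaussian P).withDensity
      (fun g => ENNReal.ofReal (Real.exp (∑ p, (m p * g p - m p ^ 2 / 2)))) := by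
    have : ∀ p, SigmaFinite ((gaussianReal 0 1).withDensity
        (fun y => ENNReal.ofReal (Real.exp (m p * y - m p ^ 2 / 2)))) := fun p => by
      rw [← gaussianReal_eq_withDensity]; infer_instance
    simp_rw [gaussianReal_eq_withDensity (m _)]
    rw [pi_withDensity_eq (fun p => by fun_prop)]
    congr 1
    funext g
    rw [Real.exp_sum, ENNReal.ofReal_prod_of_nonneg fun p _ => (Real.exp_pos _).le]
  have h2 := integral_map (μ := iidGaussian P) (φ := fun g p => m p + g p) (f := G)
    (measurable_pi_iff.2 fun p => (measurable_pi_apply p).const_add (m p)).aemeasurable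
    hG.aestronglyMeasurable
  rw [← h2, iidGaussian_map_add, h1, integral_withDensity_eq_integral_toReal_smul (by fun_prop)
      (ae_of_all _ fun _ => ENNReal.ofReal_lt_top)]
  congr 1
  funext g
  rw [ENNReal.toReal_ofReal (Real.exp_pos _).le, smul_eq_mul]

/-- Flipping the signs of some coordinates preserves the standard Gaussian product measure. -/
theorem measurePreserving_signs_iidGaussian (ε : P → ℝ) (hε : ∀ p, ε p ^ 2 = 1) :
    MeasurePreserving (fun (g : P → ℝ) p => ε p * g p) (iidGaussian P) (iidGaussian P) := by
  refine measurePreserving_pi _ _ fun p => ⟨by fun_prop, ?_⟩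
  rw [gaussianReal_map_const_mul, mul_zero]
  congr 1
  ext
  simp [hε p]

/-- Reindexing along an injection preserves standard Gaussian product measures. -/
theorem measurePreserving_comp_iidGaussian {Q : Type*} [Fintype Q] {e : Q → P}
    (he : Function.Injective e) :
    MeasurePreserving (fun g : P → ℝ => fun q => g (e q)) (iidGaussian P) (iidGaussian Q) := by
  refine ⟨by fun_prop, ?_⟩
  have h1 : iIndepFun (fun (p : P) (g : P → ℝ) => g p) (iidGaussian P) :=
    iIndepFun_pi (X := fun _ y => y) fun p => measurable_id.aemeasurable
  have h2 := (iIndepFun_iff_map_fun_eq_pi_map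
    (fun q => (measurable_pi_apply (e q)).aemeasurable)).1 (h1.precomp he)
  refine h2.trans ?_
  congr 1
  funext q
  exact (measurePreserving_eval (fun _ : P => gaussianReal 0 1) (e q)).map_eq

end

/-! ### Gradients -/

section

variable {P : Type*} [Fintype P]

/-- `DF p` is the partial derivative of `F` in the coordinate `p`. -/
def HasGrad (F : (P → ℝ) → ℝ) (DF : P → (P → ℝ) → ℝ) : Prop :=
  ∀ h, HasFDerivAt F (∑ p, DF p h • (ContinuousLinearMap.proj p : (P → ℝ) →L[ℝ] ℝ)) h

namespace HasGrad

variable {F G : (P → ℝ) → ℝ} {DF DG : P → (P → ℝ) → ℝ}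

theorem continuous (hF : HasGrad F DF) : Continuous F :=
  continuous_iff_continuousAt.2 fun h => (hF h).continuousAt

theorem add (hF : HasGrad F DF) (hG : HasGrad G DG) :
    HasGrad (fun h => F h + G h) (fun p h => DF p h + DG p h) := fun h => by
  refine ((hF h).add (hG h)).congr_fderiv ?_
  simp [add_smul, Finset.sum_add_distrib]

theorem sub (hF : HasGrad F DF) (hG : HasGrad G DG) :
    HasGrad (fun h => F h - G h) (fun p h => DF p h - DG p h) := fun h => by
  refine ((hF h).sub (hG h)).congr_fderiv ?_
  ext v
  simp [sub_mul, Finset.sum_sub_distrib]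

theorem mul (hF : HasGrad F DF) (hG : HasGrad G DG) :
    HasGrad (fun h => F h * G h) (fun p h => F h * DG p h + G h * DF p h) := fun h => by
  refine ((hF h).mul (hG h)).congr_fderiv ?_
  simp [add_smul, Finset.sum_add_distrib, Finset.smul_sum, smul_smul]

theorem const (c : ℝ) : HasGrad (fun _ : P → ℝ => c) (fun _ _ => 0) := fun h => by
  simpa using hasFDerivAt_const c h

theorem const_mul (c : ℝ) (hF : HasGrad F DF) :
    HasGrad (fun h => c * F h) (fun p h => c * DF p h) := fun h => by
  refine ((hF h).const_mul c).congr_fderiv ?_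
  simp [Finset.smul_sum, smul_smul]

theorem sum {ι : Type*} (s : Finset ι) {F : ι → (P → ℝ) → ℝ} {DF : ι → P → (P → ℝ) → ℝ}
    (hF : ∀ i, HasGrad (F i) (DF i)) :
    HasGrad (fun h => ∑ i ∈ s, F i h) (fun p h => ∑ i ∈ s, DF i p h) := fun h => by
  refine (HasFDerivAt.fun_sum fun i _ => hF i h).congr_fderiv ?_
  rw [Finset.sum_comm]
  simp [Finset.sum_smul]

theorem div (hF : HasGrad F DF) (hG : HasGrad G DG) (h0 : ∀ h, G h ≠ 0) :
    HasGrad (fun h => F h / G h) (fun p h => DF p h / G h - F h / G h * (DG p h / G h)) :=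
  fun h => by
  have h1 := (hasDerivAt_inv (h0 h)).comp_hasFDerivAt h (hG h)
  have h2 := ((hF h).mul h1).congr_of_eventuallyEq
    (Eventually.of_forall fun h => (div_eq_mul_inv (F h) (G h)))
  refine h2.congr_fderiv ?_
  have := h0 h
  ext v
  simp only [FunLike.coe_smul, Pi.smul_apply, add_apply,
    sum_apply, ContinuousLinearMap.proj_apply, smul_eq_mul, Finset.mul_sum]
  rw [← Finset.sum_add_distrib]
  refine Finset.sum_congr rfl fun p _ => ?_
  simp only [Function.comp_apply]
  field_simp
  ring

theorem exp (hF : HasGrad F DF) :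
    HasGrad (fun h => Real.exp (F h)) (fun p h => Real.exp (F h) * DF p h) := fun h => by
  refine (hF h).exp.congr_fderiv ?_
  simp [Finset.smul_sum, smul_smul]

theorem log (hF : HasGrad F DF) (h0 : ∀ h, F h ≠ 0) :
    HasGrad (fun h => Real.log (F h)) (fun p h => DF p h / F h) := fun h => by
  refine ((hF h).log (h0 h)).congr_fderiv ?_
  simp [Finset.smul_sum, smul_smul, div_eq_inv_mul]

theorem linear (a : P → ℝ) : HasGrad (fun h => ∑ p, h p * a p) (fun p _ => a p) := fun h => by
  have := (∑ p, a p • (ContinuousLinearMap.proj p : (P → ℝ) →L[ℝ] ℝ)).hasFDerivAt (x := h)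
  refine this.congr_of_eventuallyEq (Eventually.of_forall fun h => ?_)
  simp [mul_comm]

theorem hasDerivAt_comp (hF : HasGrad F DF) {k : ℝ → P → ℝ} {k' : P → ℝ} {s : ℝ}
    (hk : ∀ p, HasDerivAt (fun s => k s p) (k' p) s) :
    HasDerivAt (fun s => F (k s)) (∑ p, k' p * DF p (k s)) s := by
  refine ((hF (k s)).comp_hasDerivAt s (hasDerivAt_pi.2 hk)).congr_deriv ?_
  simp [mul_comm]

theorem hasDerivAt_update [DecidableEq P] (hF : HasGrad F DF) (p : P) (g : P → ℝ) (y : ℝ) :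
    HasDerivAt (fun y => F (Function.update g p y)) (DF p (Function.update g p y)) y := by
  have hk : ∀ q, HasDerivAt (fun y => Function.update g p y q) (if q = p then 1 else 0) y := by
    intro q
    by_cases h : q = p
    · subst h; simpa using hasDerivAt_id' y
    · simpa [Function.update_of_ne h, h] using hasDerivAt_const y (g q)
  simpa using hF.hasDerivAt_comp hk

end HasGrad

/-! ### Gaussian fields with mean equal to variance -/

/-- The field with independent Gaussian coordinates of mean and variance `t p`. -/
def gaussField (t : P → ℝ) (g : P → ℝ) : P → ℝ := fun p => t p + √(t p) * g p

omit [Fintype P] in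
theorem continuous_gaussField (t : P → ℝ) : Continuous (gaussField t) := by
  unfold gaussField
  fun_prop

theorem integrable_sum_abs_iidGaussian (b c : P → ℝ) :
    Integrable (fun g : P → ℝ => ∑ p, b p * (1 + c p * |g p|)) (iidGaussian P) := by
  refine integrable_finsetSum _ fun p _ => ?_
  exact ((integrable_const 1).add ((integrable_coord_iidGaussian p).abs.const_mul _)).const_mul _

omit [Fintype P] in
theorem abs_gaussField_le {t : P → ℝ} {T : ℝ} (ht : ∀ p, |t p| ≤ T) (g : P → ℝ) (p : P) :
    |gaussField t g p| ≤ T + √T * |g p| := by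
  refine (abs_add_le _ _).trans (add_le_add (ht p) ?_)
  rw [abs_mul, abs_of_nonneg (Real.sqrt_nonneg _)]
  gcongr
  exact (le_abs_self _).trans (ht p)

/-- The dominating function for a function of linear growth evaluated on fields with strengths
bounded by `T`. -/
theorem integrable_linear_bound (T B : ℝ) :
    Integrable (fun g : P → ℝ => B * (1 + ∑ p, (T + √T * |g p|))) (iidGaussian P) := by
  refine ((integrable_const 1).add (integrable_finsetSum _ fun p _ => ?_)).const_mul B
  exact (integrable_const T).add ((integrable_coord_iidGaussian p).abs.const_mul _)

theorem norm_le_linear_bound {F : (P → ℝ) → ℝ} {B : ℝ} (hB : 0 ≤ B)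
    (hgrow : ∀ h, |F h| ≤ B * (1 + ∑ p, |h p|)) {t : P → ℝ} {T : ℝ} (ht : ∀ p, |t p| ≤ T)
    (g : P → ℝ) : ‖F (gaussField t g)‖ ≤ B * (1 + ∑ p, (T + √T * |g p|)) := by
  refine (hgrow _).trans ?_
  gcongr with p
  exact abs_gaussField_le ht g p

theorem integrable_comp_gaussField {F : (P → ℝ) → ℝ} (hF : Continuous F) {B : ℝ} (hB : 0 ≤ B)
    (hgrow : ∀ h, |F h| ≤ B * (1 + ∑ p, |h p|)) (t : P → ℝ) :
    Integrable (fun g => F (gaussField t g)) (iidGaussian P) :=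
  (integrable_linear_bound (∑ p, |t p|) B).mono'
    (hF.comp (continuous_gaussField t)).aestronglyMeasurable
    (ae_of_all _ (norm_le_linear_bound hB hgrow fun p =>
      Finset.single_le_sum (f := fun p => |t p|) (fun _ _ => abs_nonneg _) (Finset.mem_univ p)))

/-- The expectation of a function of `gaussField` is continuous along segments. -/
theorem continuousOn_integral_gaussField {F : (P → ℝ) → ℝ} (hF : Continuous F) {B : ℝ}
    (hB : 0 ≤ B) (hgrow : ∀ h, |F h| ≤ B * (1 + ∑ p, |h p|)) (u a : P → ℝ) :
    ContinuousOn (fun s : ℝ => ∫ g, F (gaussField (fun p => u p + s * a p) g) ∂iidGaussian P)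
      (Set.Icc 0 1) := by
  set T : ℝ := ∑ p, (|u p| + |a p|) with hT
  have hbd (s : ℝ) (hs : s ∈ Set.Icc (0 : ℝ) 1) (p : P) : |u p + s * a p| ≤ T := by
    refine le_trans ?_ (Finset.single_le_sum (f := fun p => |u p| + |a p|)
      (fun _ _ => by positivity) (Finset.mem_univ p))
    refine (abs_add_le _ _).trans (add_le_add le_rfl ?_)
    rw [abs_mul, abs_of_nonneg hs.1]
    exact mul_le_of_le_one_left (abs_nonneg _) hs.2
  have hc (g : P → ℝ) : Continuous fun s : ℝ => gaussField (fun p => u p + s * a p) g :=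
    continuous_pi fun p => by unfold gaussField; fun_prop
  exact continuousOn_of_dominated
    (fun s _ => (hF.comp (continuous_gaussField _)).aestronglyMeasurable)
    (fun s hs => ae_of_all _ fun g => norm_le_linear_bound hB hgrow (hbd s hs) g)
    (integrable_linear_bound T B) (ae_of_all _ fun g => (hF.comp (hc g)).continuousOn)

/-- The heat equation for expectations of functions of `gaussField` along a segment. -/
theorem hasDerivAt_integral_gaussField {F : (P → ℝ) → ℝ} {DF : P → (P → ℝ) → ℝ}
    {HF : P → P → (P → ℝ) → ℝ} (hF : HasGrad F DF) (hDF : ∀ p, HasGrad (DF p) (HF p))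
    (hHc : ∀ p, Continuous (HF p p)) {B : ℝ} (hB : 0 ≤ B)
    (hgrow : ∀ h, |F h| ≤ B * (1 + ∑ p, |h p|)) (hDB : ∀ p h, |DF p h| ≤ B)
    (hHB : ∀ p h, |HF p p h| ≤ B) (u a : P → ℝ) (s : ℝ) (hs : ∀ p, 0 < u p + s * a p) :
    HasDerivAt (fun s : ℝ => ∫ g, F (gaussField (fun p => u p + s * a p) g) ∂iidGaussian P)
      (∫ g, (fun h => ∑ p, a p * (DF p h + 1 / 2 * HF p p h))
        (gaussField (fun p => u p + s * a p) g) ∂iidGaussian P) s := by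
  classical
  -- The square root is not differentiable at 0; a uniform lower bound on the strengths near `s`
  -- keeps the derivative of `√(u p + r * a p)` bounded.
  obtain ⟨ε, hε, hεs⟩ : ∃ ε > 0, ∀ᶠ r in 𝓝 s, ∀ p, ε ≤ u p + r * a p := by
    have : ∃ ε > 0, ∀ p, ε < u p + s * a p := by
      rcases isEmpty_or_nonempty P with hP | hP
      · exact ⟨1, one_pos, fun p => hP.elim p⟩
      · obtain ⟨p₀, hp₀⟩ := Finite.exists_min (fun p => u p + s * a p)
        exact ⟨(u p₀ + s * a p₀) / 2, half_pos (hs p₀), fun p =>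
          (half_lt_self (hs p₀)).trans_le (hp₀ p)⟩
    obtain ⟨ε, hε, h⟩ := this
    refine ⟨ε, hε, eventually_all.2 fun p => ?_⟩
    have hc : ContinuousAt (fun r : ℝ => u p + r * a p) s := by fun_prop
    exact (hc.eventually (lt_mem_nhds (h p))).mono fun _ h => h.le
  set k : ℝ → (P → ℝ) → (P → ℝ) := fun r => gaussField (fun p => u p + r * a p) with hk
  set F' : ℝ → (P → ℝ) → ℝ := fun r g =>
    ∑ p, (a p + a p / (2 * √(u p + r * a p)) * g p) * DF p (k r g) with hF'
  have hkc (r : ℝ) : Continuous (k r) := continuous_gaussField _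
  have hder (r : ℝ) (hr : ∀ p, ε ≤ u p + r * a p) (g : P → ℝ) :
      HasDerivAt (fun r => F (k r g)) (F' r g) r := by
    refine hF.hasDerivAt_comp fun p => ?_
    have h1 : HasDerivAt (fun r : ℝ => u p + r * a p) (a p) r := by
      simpa using ((hasDerivAt_id r).mul_const (a p)).const_add (u p)
    exact h1.add ((h1.sqrt (hε.trans_le (hr p)).ne').mul_const (g p))
  have hbound (r : ℝ) (hr : ∀ p, ε ≤ u p + r * a p) (g : P → ℝ) :
      ‖F' r g‖ ≤ ∑ p, (|a p| * B) * (1 + 1 / (2 * √ε) * |g p|) := by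
    refine (norm_sum_le _ _).trans (Finset.sum_le_sum fun p _ => ?_)
    have h1 : √ε ≤ √(u p + r * a p) := Real.sqrt_le_sqrt (hr p)
    have h2 : 0 < √ε := Real.sqrt_pos.2 hε
    have h4 : 0 < √(u p + r * a p) := h2.trans_le h1
    have h3 : |a p / (2 * √(u p + r * a p))| ≤ |a p| * (1 / (2 * √ε)) := by
      rw [abs_div, abs_of_pos (by positivity : 0 < 2 * √(u p + r * a p)), div_eq_mul_one_div]
      gcongr
    rw [Real.norm_eq_abs, abs_mul]
    calc |a p + a p / (2 * √(u p + r * a p)) * g p| * |DF p (k r g)|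
        ≤ (|a p| + |a p| * (1 / (2 * √ε)) * |g p|) * B := by
          gcongr
          · exact (abs_add_le _ _).trans (add_le_add le_rfl (by rw [abs_mul]; gcongr))
          · exact hDB p _
      _ = _ := by ring
  have key := (hasDerivAt_integral_of_dominated_loc_of_deriv_le (F := fun r g => F (k r g))
    (F' := F') (μ := iidGaussian P) (x₀ := s) hεs
    (Eventually.of_forall fun r => (hF.continuous.comp (hkc r)).aestronglyMeasurable)
    (integrable_comp_gaussField hF.continuous hB hgrow _)
    (Continuous.aestronglyMeasurable (by
      refine continuous_finsetSum _ fun p _ => ?_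
      exact Continuous.mul (by fun_prop) ((hDF p).continuous.comp (hkc s))))
    (ae_of_all _ fun g r hr => hbound r hr g) (integrable_sum_abs_iidGaussian _ _)
    (ae_of_all _ fun g r hr => hder r hr g)).2
  refine key.congr_deriv ?_
  have hiD (p : P) : Integrable (fun g => DF p (k s g)) (iidGaussian P) :=
    Integrable.of_bound ((hDF p).continuous.comp (hkc s)).aestronglyMeasurable B
      (ae_of_all _ fun g => hDB p _)
  have hiH (p : P) : Integrable (fun g => HF p p (k s g)) (iidGaussian P) :=
    Integrable.of_bound ((hHc p).comp (hkc s)).aestronglyMeasurable B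
      (ae_of_all _ fun g => hHB p _)
  have higD (p : P) : Integrable (fun g => g p * DF p (k s g)) (iidGaussian P) :=
    (integrable_coord_iidGaussian p).mul_bdd ((hDF p).continuous.comp (hkc s)).aestronglyMeasurable
      (ae_of_all _ fun g => hDB p _)
  -- Integration by parts produces a factor `√(u p + s * a p)`, which cancels the one in the
  -- derivative of the square root and leaves the coefficient 1/2 of the heat equation.
  have hibp (p : P) : ∫ g, g p * DF p (k s g) ∂iidGaussian P =
      √(u p + s * a p) * ∫ g, HF p p (k s g) ∂iidGaussian P := by
    rw [← integral_const_mul]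
    refine integral_coord_mul_iidGaussian (B := max B (√(u p + s * a p) * B)) p (fun g y => ?_)
      ((hDF p).continuous.comp (hkc s)) (continuous_const.mul ((hHc p).comp (hkc s)))
      (fun g => (hDB p _).trans (le_max_left _ _)) (fun g => ?_)
    · have e (y : ℝ) : k s (Function.update g p y) =
          Function.update (k s g) p (u p + s * a p + √(u p + s * a p) * y) := by
        funext q
        by_cases h : q = p
        · subst h; simp [hk, gaussField]
        · simp [hk, gaussField, Function.update_of_ne h]
      have h1 : HasDerivAt (fun y : ℝ => u p + s * a p + √(u p + s * a p) * y)
          (√(u p + s * a p)) y := by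
        simpa using ((hasDerivAt_id y).const_mul (√(u p + s * a p))).const_add (u p + s * a p)
      have h2 := ((hDF p).hasDerivAt_update p (k s g) (u p + s * a p + √(u p + s * a p) * y)).comp
        y h1
      rw [mul_comm (HF p p _)] at h2
      simp only [e]
      exact h2
    · rw [abs_mul, abs_of_nonneg (Real.sqrt_nonneg _)]
      exact (mul_le_mul_of_nonneg_left (hHB p _) (Real.sqrt_nonneg _)).trans (le_max_right _ _)
  have e1 (g : P → ℝ) : F' s g = ∑ p, (a p * DF p (k s g) +
      a p / (2 * √(u p + s * a p)) * (g p * DF p (k s g))) :=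
    Finset.sum_congr rfl fun p _ => by ring
  simp_rw [e1]
  have hi1 (p : P) : Integrable (fun g => a p * DF p (k s g) +
      a p / (2 * √(u p + s * a p)) * (g p * DF p (k s g))) (iidGaussian P) :=
    ((hiD p).const_mul _).add ((higD p).const_mul _)
  have hi2 (p : P) : Integrable (fun g => a p * (DF p (k s g) + 1 / 2 * HF p p (k s g)))
      (iidGaussian P) := ((hiD p).add ((hiH p).const_mul _)).const_mul _
  rw [integral_finsetSum _ fun p _ => hi1 p, integral_finsetSum _ fun p _ => hi2 p]
  refine Finset.sum_congr rfl fun p _ => ?_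
  rw [integral_add ((hiD p).const_mul _) ((higD p).const_mul _), integral_const_mul,
    integral_const_mul, hibp, integral_const_mul, integral_add (hiD p) ((hiH p).const_mul _),
    integral_const_mul]
  have := (Real.sqrt_pos.2 (hs p)).ne'
  generalize √(u p + s * a p) = w at this ⊢
  field_simp

end

/-! ### Gibbs averages -/

section

variable {P C : Type*} [Fintype P] [Fintype C]

/-- The Boltzmann weight of a configuration `c` in the field `h` coupled to the observables `x`. -/
def gibbsWeight (x : P → C → ℝ) (h : P → ℝ) (c : C) : ℝ := Real.exp (∑ p, h p * x p c)

/-- The partition function in the field `h`. -/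
def gibbsZ (x : P → C → ℝ) (h : P → ℝ) : ℝ := ∑ c, gibbsWeight x h c

/-- The Gibbs average of `f` in the field `h`. -/
def gibbsAvg (x : P → C → ℝ) (f : C → ℝ) (h : P → ℝ) : ℝ :=
  (∑ c, f c * gibbsWeight x h c) / gibbsZ x h

/-- The Gibbs covariance of the observables `x p` and `x q`. -/
def gibbsCov (x : P → C → ℝ) (p q : P) (h : P → ℝ) : ℝ :=
  gibbsAvg x (fun c => x p c * x q c) h - gibbsAvg x (x p) h * gibbsAvg x (x q) h

variable {x : P → C → ℝ}

omit [Fintype C] in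
theorem gibbsWeight_pos (h : P → ℝ) (c : C) : 0 < gibbsWeight x h c := Real.exp_pos _

omit [Fintype C] in
theorem hasGrad_gibbsWeight (c : C) :
    HasGrad (fun h => gibbsWeight x h c) (fun p h => gibbsWeight x h c * x p c) :=
  (HasGrad.linear fun p => x p c).exp

theorem hasGrad_gibbsZ :
    HasGrad (gibbsZ x) (fun p h => ∑ c, gibbsWeight x h c * x p c) :=
  HasGrad.sum Finset.univ hasGrad_gibbsWeight

variable [Nonempty C]

theorem gibbsZ_pos (h : P → ℝ) : 0 < gibbsZ x h :=
  Finset.sum_pos (fun c _ => gibbsWeight_pos h c) Finset.univ_nonempty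

theorem gibbsZ_ne_zero (h : P → ℝ) : gibbsZ x h ≠ 0 := (gibbsZ_pos h).ne'

theorem sum_mul_gibbsWeight (f : C → ℝ) (h : P → ℝ) :
    ∑ c, f c * gibbsWeight x h c = gibbsZ x h * gibbsAvg x f h :=
  (mul_div_cancel₀ _ (gibbsZ_ne_zero h)).symm

theorem hasGrad_gibbsAvg (f : C → ℝ) :
    HasGrad (gibbsAvg x f) (fun p h => gibbsAvg x (fun c => f c * x p c) h -
      gibbsAvg x f h * gibbsAvg x (x p) h) := fun h => by
  refine ((HasGrad.div (HasGrad.sum Finset.univ fun c => (hasGrad_gibbsWeight c).const_mul (f c))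
    hasGrad_gibbsZ gibbsZ_ne_zero) h).congr_fderiv ?_
  refine Finset.sum_congr rfl fun p _ => ?_
  simp only [gibbsAvg]
  have e1 : ∑ c, f c * (gibbsWeight x h c * x p c) = ∑ c, f c * x p c * gibbsWeight x h c :=
    Finset.sum_congr rfl fun c _ => by ring
  have e2 : ∑ c, gibbsWeight x h c * x p c = ∑ c, x p c * gibbsWeight x h c :=
    Finset.sum_congr rfl fun c _ => by ring
  rw [e1, e2]

theorem continuous_gibbsAvg (f : C → ℝ) : Continuous (gibbsAvg x f) :=
  (hasGrad_gibbsAvg f).continuous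

theorem hasGrad_log_gibbsZ :
    HasGrad (fun h => Real.log (gibbsZ x h)) (fun p => gibbsAvg x (x p)) := fun h => by
  refine (hasGrad_gibbsZ.log gibbsZ_ne_zero h).congr_fderiv ?_
  refine Finset.sum_congr rfl fun p _ => ?_
  simp only [gibbsAvg]
  congr 2
  exact Finset.sum_congr rfl fun c _ => by ring

theorem hasGrad_gibbsCov (p q : P) :
    HasGrad (gibbsCov x p q) (fun r h => gibbsAvg x (fun c => x p c * x q c * x r c) h -
      gibbsAvg x (fun c => x p c * x q c) h * gibbsAvg x (x r) h -
      (gibbsAvg x (x p) h * gibbsCov x q r h + gibbsAvg x (x q) h * gibbsCov x p r h)) :=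
  (hasGrad_gibbsAvg _).sub ((hasGrad_gibbsAvg _).mul (hasGrad_gibbsAvg _))

theorem continuous_gibbsCov (p q : P) : Continuous (gibbsCov x p q) :=
  (hasGrad_gibbsCov p q).continuous

theorem abs_gibbsAvg_le {f : C → ℝ} {B : ℝ} (hf : ∀ c, |f c| ≤ B) (h : P → ℝ) :
    |gibbsAvg x f h| ≤ B := by
  rw [gibbsAvg, abs_div, abs_of_pos (gibbsZ_pos h), div_le_iff₀ (gibbsZ_pos h), gibbsZ,
    Finset.mul_sum]
  refine (Finset.abs_sum_le_sum_abs _ _).trans (Finset.sum_le_sum fun c _ => ?_)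
  rw [abs_mul, abs_of_pos (gibbsWeight_pos h c)]
  exact mul_le_mul_of_nonneg_right (hf c) (gibbsWeight_pos h c).le

theorem gibbsAvg_const (b : ℝ) (h : P → ℝ) : gibbsAvg x (fun _ => b) h = b := by
  rw [gibbsAvg, ← Finset.mul_sum]
  exact mul_div_cancel_right₀ _ (gibbsZ_ne_zero h)

/-- The centred form exhibits the covariance matrix as a Gram matrix, which is what makes its
entrywise square tractable. -/
theorem gibbsCov_eq_sum (p q : P) (h : P → ℝ) :
    gibbsCov x p q h = ∑ c, gibbsWeight x h c / gibbsZ x h *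
      ((x p c - gibbsAvg x (x p) h) * (x q c - gibbsAvg x (x q) h)) := by
  have e (c : C) : gibbsWeight x h c / gibbsZ x h *
      ((x p c - gibbsAvg x (x p) h) * (x q c - gibbsAvg x (x q) h)) =
      (x p c * x q c * gibbsWeight x h c - gibbsAvg x (x p) h * (x q c * gibbsWeight x h c)
        - gibbsAvg x (x q) h * (x p c * gibbsWeight x h c)
        + gibbsAvg x (x p) h * gibbsAvg x (x q) h * (1 * gibbsWeight x h c)) / gibbsZ x h := by
    ring
  simp_rw [e]
  rw [← Finset.sum_div, Finset.sum_add_distrib, Finset.sum_sub_distrib, Finset.sum_sub_distrib,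
    ← Finset.mul_sum, ← Finset.mul_sum, ← Finset.mul_sum, sum_mul_gibbsWeight (fun _ => (1 : ℝ)),
    sum_mul_gibbsWeight (fun c => x p c * x q c), sum_mul_gibbsWeight, sum_mul_gibbsWeight,
    gibbsAvg_const, gibbsCov]
  have := gibbsZ_ne_zero (x := x) h
  field_simp
  ring

/-- The entrywise square of the covariance matrix is positive semidefinite. -/
theorem sum_gibbsCov_sq_nonneg (a : P → ℝ) (h : P → ℝ) :
    0 ≤ ∑ q, a q * ∑ p, a p * gibbsCov x p q h ^ 2 := by
  set W : C → ℝ := fun c => gibbsWeight x h c / gibbsZ x h with hW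
  set Y : P → C → ℝ := fun p c => x p c - gibbsAvg x (x p) h with hY
  -- Two replicas `c`, `c'`: the squared covariance is the second-moment matrix of the products `Y p
  -- c * Y p c'`, so the quadratic form is a weighted sum of squares.
  have e (p q : P) : gibbsCov x p q h ^ 2 =
      ∑ c, ∑ c', W c * W c' * ((Y p c * Y p c') * (Y q c * Y q c')) := by
    rw [gibbsCov_eq_sum, sq, Finset.sum_mul_sum]
    exact Finset.sum_congr rfl fun c _ => Finset.sum_congr rfl fun c' _ => by
      simp only [hW, hY]; ring
  have e2 : ∑ q, a q * ∑ p, a p * gibbsCov x p q h ^ 2 =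
      ∑ c, ∑ c', W c * W c' * (∑ p, a p * (Y p c * Y p c')) ^ 2 := by
    simp_rw [e, sq, Finset.sum_mul_sum, Finset.mul_sum]
    calc _ = ∑ q, ∑ c, ∑ c', ∑ p,
          a q * (a p * (W c * W c' * ((Y p c * Y p c') * (Y q c * Y q c')))) := by
          refine Finset.sum_congr rfl fun q _ => ?_
          rw [Finset.sum_comm]
          exact Finset.sum_congr rfl fun c _ => Finset.sum_comm
      _ = ∑ c, ∑ c', ∑ q, ∑ p,
          a q * (a p * (W c * W c' * ((Y p c * Y p c') * (Y q c * Y q c')))) := by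
          rw [Finset.sum_comm]
          exact Finset.sum_congr rfl fun c _ => Finset.sum_comm
      _ = _ := by
          refine Finset.sum_congr rfl fun c _ => Finset.sum_congr rfl fun c' _ =>
            Finset.sum_congr rfl fun q _ => Finset.sum_congr rfl fun p _ => by ring
  rw [e2]
  refine Finset.sum_nonneg fun c _ => Finset.sum_nonneg fun c' _ => ?_
  have hWp (c : C) : 0 ≤ W c := div_nonneg (gibbsWeight_pos h c).le (gibbsZ_pos h).le
  exact mul_nonneg (mul_nonneg (hWp c) (hWp c')) (sq_nonneg _)

/-! ### Bounds for observables with values ±1 -/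

section Signs

variable (hsq : ∀ p c, x p c ^ 2 = 1)
include hsq

omit [Fintype P] [Fintype C] [Nonempty C] in
theorem abs_eq_one_of_sq (p : P) (c : C) : |x p c| = 1 := by
  rw [← pow_eq_one_iff_of_nonneg (abs_nonneg _) two_ne_zero, sq_abs, hsq]

theorem abs_gibbsAvg_coord_le (p : P) (h : P → ℝ) : |gibbsAvg x (x p) h| ≤ 1 :=
  abs_gibbsAvg_le (fun c => (abs_eq_one_of_sq hsq p c).le) h

theorem abs_gibbsAvg_mul_le (p q : P) (h : P → ℝ) :
    |gibbsAvg x (fun c => x p c * x q c) h| ≤ 1 :=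
  abs_gibbsAvg_le (fun c => by rw [abs_mul, abs_eq_one_of_sq hsq, abs_eq_one_of_sq hsq]; simp) h

theorem abs_gibbsCov_le (p q : P) (h : P → ℝ) : |gibbsCov x p q h| ≤ 2 := by
  have h1 := abs_gibbsAvg_mul_le hsq p q h
  have h2 := abs_gibbsAvg_coord_le hsq p h
  have h3 := abs_gibbsAvg_coord_le hsq q h
  have h4 : |gibbsAvg x (x p) h * gibbsAvg x (x q) h| ≤ 1 := by
    rw [abs_mul]; exact mul_le_one₀ h2 (abs_nonneg _) h3
  exact (abs_sub _ _).trans (by linarith)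

theorem gibbsCov_self (p : P) (h : P → ℝ) :
    gibbsCov x p p h = 1 - gibbsAvg x (x p) h * gibbsAvg x (x p) h := by
  have : (fun c => x p c * x p c) = fun _ => 1 := by
    funext c; rw [← sq, hsq]
  rw [gibbsCov, this, gibbsAvg_const]

omit [Nonempty C] in
theorem gibbsAvg_triple (p q : P) (h : P → ℝ) :
    gibbsAvg x (fun c => x p c * x q c * x q c) h = gibbsAvg x (x p) h := by
  congr 1
  funext c
  rw [mul_assoc, ← sq, hsq, mul_one]

/-- Every exponent is at most ∑ |h p| in absolute value, so Z lies between exp(-∑ |h p|) and |C|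
exp(∑ |h p|). The product form on the right is the growth condition required by the heat equation.
-/
theorem abs_log_gibbsZ_le (h : P → ℝ) :
    |Real.log (gibbsZ x h)| ≤ (1 + Real.log (Fintype.card C)) * (1 + ∑ p, |h p|) := by
  have hw (c : C) : |∑ p, h p * x p c| ≤ ∑ p, |h p| :=
    (Finset.abs_sum_le_sum_abs _ _).trans (Finset.sum_le_sum fun p _ => by
      rw [abs_mul, abs_eq_one_of_sq hsq, mul_one])
  have hcard : (1 : ℝ) ≤ Fintype.card C := by exact_mod_cast Fintype.card_pos
  have hS : 0 ≤ ∑ p, |h p| := Finset.sum_nonneg fun _ _ => abs_nonneg _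
  have hl : 0 ≤ Real.log (Fintype.card C) := Real.log_nonneg hcard
  have hup : gibbsZ x h ≤ Fintype.card C * Real.exp (∑ p, |h p|) := by
    have := Finset.sum_le_card_nsmul Finset.univ (gibbsWeight x h) (Real.exp (∑ p, |h p|))
      fun c _ => Real.exp_le_exp.2 ((le_abs_self _).trans (hw c))
    simpa [gibbsZ] using this
  have hlo : Real.exp (-∑ p, |h p|) ≤ gibbsZ x h := by
    obtain ⟨c⟩ := ‹Nonempty C›
    exact (Real.exp_le_exp.2 (neg_le_of_abs_le (hw c))).trans
      (Finset.single_le_sum (fun c _ => (gibbsWeight_pos h c).le) (Finset.mem_univ c))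
  have h1 := Real.log_le_log (gibbsZ_pos h) hup
  rw [Real.log_mul (by positivity) (Real.exp_pos _).ne', Real.log_exp] at h1
  have h2 := Real.log_le_log (Real.exp_pos _) hlo
  rw [Real.log_exp] at h2
  rw [abs_le]
  constructor <;> nlinarith [mul_nonneg hl hS]

end Signs

/-! ### Gauge symmetry -/

omit [Fintype C] [Nonempty C] in
-- The observables are characters of the group of configurations, so twisting the field by the signs
-- of `τ` amounts to translating the configuration by `τ`.
theorem gibbsWeight_gauge [Group C] (hmul : ∀ p c d, x p (c * d) = x p c * x p d) (τ : C)
    (h : P → ℝ) (c : C) : gibbsWeight x (fun p => x p τ * h p) c = gibbsWeight x h (τ * c) := by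
  simp only [gibbsWeight, hmul]
  congr 1
  exact Finset.sum_congr rfl fun p _ => by ring

omit [Nonempty C] in
theorem gibbsZ_gauge [Group C] (hmul : ∀ p c d, x p (c * d) = x p c * x p d) (τ : C) (h : P → ℝ) :
    gibbsZ x (fun p => x p τ * h p) = gibbsZ x h := by
  simp only [gibbsZ, gibbsWeight_gauge hmul]
  exact (Group.mulLeft_bijective τ).sum_comp (gibbsWeight x h)

omit [Nonempty C] in
theorem gibbsAvg_gauge [Group C] (hmul : ∀ p c d, x p (c * d) = x p c * x p d) (τ : C) {f : C → ℝ}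
    {χ : ℝ} (hχ : χ ^ 2 = 1) (hf : ∀ c, f (τ * c) = χ * f c) (h : P → ℝ) :
    gibbsAvg x f (fun p => x p τ * h p) = χ * gibbsAvg x f h := by
  have e : ∑ c, f (τ * c) * gibbsWeight x h (τ * c) = ∑ c, f c * gibbsWeight x h c :=
    (Group.mulLeft_bijective τ).sum_comp fun c => f c * gibbsWeight x h c
  have e2 (c : C) : f c = χ * f (τ * c) := by rw [hf, ← mul_assoc, ← sq, hχ, one_mul]
  rw [gibbsAvg, gibbsZ_gauge hmul, gibbsAvg, ← mul_div_assoc, ← e, Finset.mul_sum]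
  congr 1
  refine Finset.sum_congr rfl fun c _ => ?_
  rw [gibbsWeight_gauge hmul, ← mul_assoc, ← e2]

omit [Nonempty C] in
theorem gibbsCov_gauge [Group C] (hsq : ∀ p c, x p c ^ 2 = 1)
    (hmul : ∀ p c d, x p (c * d) = x p c * x p d) (τ : C) (p q : P) (h : P → ℝ) :
    gibbsCov x p q (fun p => x p τ * h p) = x p τ * x q τ * gibbsCov x p q h := by
  have h2 : (x p τ * x q τ) ^ 2 = 1 := by rw [mul_pow, hsq, hsq, one_mul]
  rw [gibbsCov, gibbsCov, gibbsAvg_gauge hmul τ h2 (fun c => by rw [hmul, hmul]; ring),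
    gibbsAvg_gauge hmul τ (hsq p τ) (hmul p τ), gibbsAvg_gauge hmul τ (hsq q τ) (hmul q τ)]
  ring

theorem integrable_exp_linear_iidGaussian (m : P → ℝ) :
    Integrable (fun g : P → ℝ => Real.exp (∑ p, (m p * g p - m p ^ 2 / 2))) (iidGaussian P) := by
  have := Integrable.fintype_prod (μ := fun _ : P => gaussianReal 0 1)
    (f := fun p y => Real.exp (m p * y - m p ^ 2 / 2)) fun p => by
      simp_rw [sub_eq_add_neg, Real.exp_add]
      exact (integrable_exp_mul_gaussianReal (m p)).mul_const _
  simpa only [Real.exp_sum] using this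

/-- On the Nishimori line, an observable whose planted average is pointwise nonnegative has
nonnegative expectation. -/
theorem integral_gaussField_nonneg (hsq : ∀ p c, x p c ^ 2 = 1) {A : (P → ℝ) → ℝ}
    (hA : Continuous A) {B : ℝ} (hB : ∀ h, |A h| ≤ B)
    (hpos : ∀ h, 0 ≤ ∑ τ, A (fun p => x p τ * h p) * gibbsWeight x h τ)
    {t : P → ℝ} (ht : ∀ p, 0 ≤ t p) :
    0 ≤ ∫ g, A (gaussField t g) ∂iidGaussian P := by
  -- Cameron–Martin removes the mean of the field at the cost of a density, and then the signs of
  -- the Gaussians are flipped by `τ`. Each `I τ` thus has the same integral as the original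
  -- observable, and one may sum over `τ`.
  set I : C → (P → ℝ) → ℝ := fun τ g =>
    Real.exp (∑ p, (√(t p) * x p τ * g p - (√(t p) * x p τ) ^ 2 / 2)) *
      A (fun p => x p τ * (√(t p) * g p)) with hI
  have hint (τ : C) : Integrable (I τ) (iidGaussian P) := by
    refine (integrable_exp_linear_iidGaussian _).mul_bdd (c := B) (Continuous.aestronglyMeasurable ?_)
      (ae_of_all _ fun g => hB _)
    exact hA.comp (by fun_prop)
  have heq (τ : C) : ∫ g, A (gaussField t g) ∂iidGaussian P = ∫ g, I τ g ∂iidGaussian P := by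
    have h1 := integral_add_iidGaussian (fun p => √(t p)) (G := fun g => A fun p => √(t p) * g p)
      (Continuous.measurable (hA.comp (by fun_prop)))
    have e1 : ∫ g, A (gaussField t g) ∂iidGaussian P =
        ∫ g, A (fun p => √(t p) * (√(t p) + g p)) ∂iidGaussian P := by
      congr 1; funext g; congr 1; funext p
      rw [gaussField, mul_add, Real.mul_self_sqrt (ht p)]
    have mp := measurePreserving_signs_iidGaussian (fun p => x p τ) (fun p => hsq p τ)
    have h2 := integral_map (μ := iidGaussian P) mp.measurable.aemeasurable
      (f := fun g => Real.exp (∑ p, (√(t p) * g p - √(t p) ^ 2 / 2)) *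
        A (fun p => √(t p) * g p)) (Continuous.aestronglyMeasurable (by
          refine Continuous.mul (by fun_prop) (hA.comp (by fun_prop))))
    rw [mp.map_eq] at h2
    rw [e1, h1, h2]
    congr 1; funext g
    simp only [hI]
    congr 2
    · refine Finset.sum_congr rfl fun p _ => ?_
      rw [mul_pow, hsq, mul_one, mul_assoc]
    · funext p; ring
  have hcard : (0 : ℝ) < Fintype.card C := by exact_mod_cast Fintype.card_pos
  have hsum : (Fintype.card C : ℝ) * ∫ g, A (gaussField t g) ∂iidGaussian P =
      ∫ g, ∑ τ, I τ g ∂iidGaussian P := by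
    rw [integral_finsetSum _ fun τ _ => hint τ]
    simp [← heq]
  refine nonneg_of_mul_nonneg_right ?_ hcard
  rw [hsum]
  refine integral_nonneg fun g => ?_
  -- Since mean equals variance and the observables are ±1, the quadratic part of the density does
  -- not depend on `τ` and the linear part is exactly the Gibbs weight of `τ`: here the Nishimori
  -- condition is used.
  have e (τ : C) : I τ g = Real.exp (-∑ p, t p / 2) *
      (A (fun p => x p τ * (√(t p) * g p)) * gibbsWeight x (fun p => √(t p) * g p) τ) := by
    have : ∑ p, (√(t p) * x p τ * g p - (√(t p) * x p τ) ^ 2 / 2) =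
        -∑ p, t p / 2 + ∑ p, √(t p) * g p * x p τ := by
      rw [← Finset.sum_neg_distrib, ← Finset.sum_add_distrib]
      refine Finset.sum_congr rfl fun p _ => ?_
      rw [mul_pow, hsq, Real.sq_sqrt (ht p)]; ring
    simp only [hI, gibbsWeight]
    rw [this, Real.exp_add]; ring
  simp only [e, Pi.zero_apply]
  rw [← Finset.mul_sum]
  exact mul_nonneg (Real.exp_pos _).le (hpos _)

/-! ### Convexity of the free entropy on the Nishimori line -/

/-- The expected logarithm of the partition function in the field `gaussField t`. -/
def freeEntropy (x : P → C → ℝ) (t : P → ℝ) : ℝ :=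
  ∫ g, Real.log (gibbsZ x (gaussField t g)) ∂iidGaussian P

/-- The observable whose expectation is the partial derivative of the free entropy. -/
def overlapObs (x : P → C → ℝ) (p : P) (h : P → ℝ) : ℝ :=
  gibbsAvg x (x p) h + 1 / 2 * (1 - gibbsAvg x (x p) h * gibbsAvg x (x p) h)

theorem hasGrad_overlapObs (p : P) :
    HasGrad (overlapObs x p) (fun q h => (1 - gibbsAvg x (x p) h) * gibbsCov x p q h) := fun h => by
  have h1 := hasGrad_gibbsAvg (x := x) (x p)
  refine ((h1.add (((HasGrad.const 1).sub (h1.mul h1)).const_mul (1 / 2))) h).congr_fderiv ?_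
  refine Finset.sum_congr rfl fun q _ => ?_
  simp only [gibbsCov]
  congr 1
  ring

theorem hasGrad_deriv_overlapObs (p q : P) :
    HasGrad (fun h => (1 - gibbsAvg x (x p) h) * gibbsCov x p q h)
      (fun r h => (1 - gibbsAvg x (x p) h) *
        (gibbsAvg x (fun c => x p c * x q c * x r c) h -
          gibbsAvg x (fun c => x p c * x q c) h * gibbsAvg x (x r) h -
          (gibbsAvg x (x p) h * gibbsCov x q r h + gibbsAvg x (x q) h * gibbsCov x p r h)) +
        gibbsCov x p q h * (0 - gibbsCov x p r h)) :=
  ((HasGrad.const 1).sub (hasGrad_gibbsAvg _)).mul (hasGrad_gibbsCov p q)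

theorem overlapObs_abs_le (hsq : ∀ p c, x p c ^ 2 = 1) (p : P) (h : P → ℝ) :
    |overlapObs x p h| ≤ 1 := by
  have := abs_le.1 (abs_gibbsAvg_coord_le hsq p h)
  rw [overlapObs, abs_le]
  constructor <;> nlinarith

end

section

variable {P C : Type*} [Fintype P] [Fintype C] [Nonempty C] {x : P → C → ℝ}

/-- The heat equation for log Z: its gradient consists of Gibbs averages, and its diagonal second
derivatives are the variances, equal to 1 - m_p² for ±1 observables. -/
theorem hasDerivAt_freeEntropy (hsq : ∀ p c, x p c ^ 2 = 1) (u a : P → ℝ) (s : ℝ)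
    (hs : ∀ p, 0 < u p + s * a p) :
    HasDerivAt (fun s : ℝ => freeEntropy x (fun p => u p + s * a p))
      (∫ g, ∑ p, a p * overlapObs x p (gaussField (fun p => u p + s * a p) g) ∂iidGaussian P)
      s := by
  have hl : 0 ≤ Real.log (Fintype.card C) :=
    Real.log_nonneg (by exact_mod_cast Fintype.card_pos)
  have hB : 0 ≤ 2 + Real.log (Fintype.card C) := by linarith
  refine (hasDerivAt_integral_gaussField (F := fun h => Real.log (gibbsZ x h))
    (HF := gibbsCov x) (B := 2 + Real.log (Fintype.card C)) hasGrad_log_gibbsZ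
    (fun p => hasGrad_gibbsAvg (x p)) (fun p => continuous_gibbsCov p p) hB
    (fun h => (abs_log_gibbsZ_le hsq h).trans ?_)
    (fun p h => (abs_gibbsAvg_coord_le hsq p h).trans (by linarith))
    (fun p h => (abs_gibbsCov_le hsq p p h).trans (by linarith)) u a s hs).congr_deriv ?_
  · have : 0 ≤ ∑ p, |h p| := Finset.sum_nonneg fun _ _ => abs_nonneg _
    gcongr
    norm_num
  · simp only [gibbsCov_self hsq, overlapObs]

/-- The second derivative of the free entropy, as an observable. -/
def convexityObs (x : P → C → ℝ) (a : P → ℝ) (h : P → ℝ) : ℝ :=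
  ∑ q, a q * ∑ p, a p * ((1 - gibbsAvg x (x p) h) * gibbsCov x p q h -
    (1 - gibbsAvg x (x p) h) * gibbsAvg x (x q) h * gibbsCov x p q h -
    1 / 2 * gibbsCov x p q h ^ 2)

theorem abs_sum_mul_le (a v : P → ℝ) {B : ℝ} (hv : ∀ p, |v p| ≤ B) :
    |∑ p, a p * v p| ≤ B * ∑ p, |a p| := by
  rw [Finset.mul_sum]
  refine (Finset.abs_sum_le_sum_abs _ _).trans (Finset.sum_le_sum fun p _ => ?_)
  rw [abs_mul, mul_comm]
  exact mul_le_mul_of_nonneg_right (hv p) (abs_nonneg _)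

theorem abs_one_sub_gibbsAvg_le (hsq : ∀ p c, x p c ^ 2 = 1) (p : P) (h : P → ℝ) :
    |1 - gibbsAvg x (x p) h| ≤ 2 := by
  have := abs_le.1 (abs_gibbsAvg_coord_le hsq p h)
  rw [abs_le]
  constructor <;> linarith

theorem hasDerivAt_deriv_freeEntropy (hsq : ∀ p c, x p c ^ 2 = 1) (u a : P → ℝ) (s : ℝ)
    (hs : ∀ p, 0 < u p + s * a p) :
    HasDerivAt (fun s : ℝ => ∫ g, ∑ p, a p * overlapObs x p (gaussField (fun p => u p + s * a p) g)
      ∂iidGaussian P)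
      (∫ g, convexityObs x a (gaussField (fun p => u p + s * a p) g) ∂iidGaussian P) s := by
  have hA : 0 ≤ ∑ p, |a p| := Finset.sum_nonneg fun _ _ => abs_nonneg _
  have hmul {y z b c : ℝ} (hy : |y| ≤ b) (hz : |z| ≤ c) : |y * z| ≤ b * c := by
    rw [abs_mul]; exact mul_le_mul hy hz (abs_nonneg _) ((abs_nonneg _).trans hy)
  -- Because `x q` squares to 1, the triple average and the variance of `x q` collapse, and the
  -- second derivative is expressed by m and C alone.
  have hH (p q : P) (h : P → ℝ) :
      (1 - gibbsAvg x (x p) h) * (gibbsAvg x (fun c => x p c * x q c * x q c) h -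
          gibbsAvg x (fun c => x p c * x q c) h * gibbsAvg x (x q) h -
          (gibbsAvg x (x p) h * gibbsCov x q q h + gibbsAvg x (x q) h * gibbsCov x p q h)) +
        gibbsCov x p q h * (0 - gibbsCov x p q h) =
      (1 - gibbsAvg x (x p) h) * (-2 * gibbsAvg x (x q) h * gibbsCov x p q h) -
        gibbsCov x p q h * gibbsCov x p q h := by
    rw [gibbsAvg_triple hsq, gibbsCov_self hsq]
    simp only [gibbsCov]
    ring
  -- The constant is 2·(2·1·2) + 2·2, from |1 - m| ≤ 2, |m| ≤ 1 and |C| ≤ 2 in the second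
  -- derivative; it also covers the weaker bounds.
  refine (hasDerivAt_integral_gaussField (B := 12 * ∑ p, |a p|)
    (HasGrad.sum Finset.univ fun p => (hasGrad_overlapObs (x := x) p).const_mul (a p))
    (fun q => HasGrad.sum Finset.univ fun p => (hasGrad_deriv_overlapObs p q).const_mul (a p))
    (fun q => ?_) (by positivity) (fun h => ?_) (fun q h => ?_) (fun q h => ?_)
    u a s hs).congr_deriv ?_
  · simp only [hH]
    have h1 := continuous_gibbsAvg (x := x)
    have h2 := continuous_gibbsCov (x := x)
    refine continuous_finsetSum _ fun p _ => ?_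
    have := h1 (x p)
    have := h1 (x q)
    have := h2 p q
    fun_prop
  · have h0 : 0 ≤ ∑ p, |h p| := Finset.sum_nonneg fun _ _ => abs_nonneg _
    refine (abs_sum_mul_le a _ fun p => overlapObs_abs_le hsq p h).trans ?_
    nlinarith [mul_nonneg hA h0]
  · refine (abs_sum_mul_le a _ fun p => hmul (abs_one_sub_gibbsAvg_le hsq p h)
      (abs_gibbsCov_le hsq p q h)).trans ?_
    nlinarith
  · simp only [hH]
    refine (abs_sum_mul_le a _ (B := 12) fun p => ?_)
    have h2 : |(-2 : ℝ)| ≤ 2 := by norm_num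
    refine (abs_sub _ _).trans ((add_le_add
      (hmul (abs_one_sub_gibbsAvg_le hsq p h)
        (hmul (hmul h2 (abs_gibbsAvg_coord_le hsq q h)) (abs_gibbsCov_le hsq p q h)))
      (hmul (abs_gibbsCov_le hsq p q h) (abs_gibbsCov_le hsq p q h))).trans (by norm_num))
  · congr 1
    funext g
    simp only [convexityObs, hH]
    refine Finset.sum_congr rfl fun q _ => ?_
    congr 1
    rw [Finset.mul_sum, ← Finset.sum_add_distrib]
    exact Finset.sum_congr rfl fun p _ => by ring

/-- Under the gauge change C_pq acquires the sign x_p x_q and m_p the sign x_p. Averaging these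
signs with the Gibbs weight turns the terms linear in C into C_pq (⟨x_p x_q⟩ - m_p m_q) = C_pq², and
subtracting C_pq²/2 leaves half a Schur square. -/
theorem sum_convexityObs_gauge_nonneg [Group C] (hsq : ∀ p c, x p c ^ 2 = 1)
    (hmul : ∀ p c d, x p (c * d) = x p c * x p d) (a h : P → ℝ) :
    0 ≤ ∑ τ, convexityObs x a (fun p => x p τ * h p) * gibbsWeight x h τ := by
  have e (τ : C) : convexityObs x a (fun p => x p τ * h p) * gibbsWeight x h τ =
      ∑ q, a q * ∑ p, a p * (gibbsCov x p q h * (x p τ * x q τ * gibbsWeight x h τ) -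
        gibbsAvg x (x p) h * gibbsCov x p q h * (x q τ * gibbsWeight x h τ) -
        gibbsAvg x (x q) h * gibbsCov x p q h * (x p τ * gibbsWeight x h τ) +
        (gibbsAvg x (x p) h * gibbsAvg x (x q) h * gibbsCov x p q h -
          1 / 2 * gibbsCov x p q h ^ 2) * (1 * gibbsWeight x h τ)) := by
    rw [convexityObs, Finset.sum_mul]
    refine Finset.sum_congr rfl fun q _ => ?_
    rw [mul_assoc, Finset.sum_mul]
    congr 1
    refine Finset.sum_congr rfl fun p _ => ?_
    rw [gibbsCov_gauge hsq hmul, gibbsAvg_gauge hmul τ (hsq p τ) (hmul p τ),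
      gibbsAvg_gauge hmul τ (hsq q τ) (hmul q τ)]
    have hp := hsq p τ
    have hq := hsq q τ
    linear_combination (a p * gibbsWeight x h τ) *
      ((-gibbsAvg x (x p) h * gibbsCov x p q h * x q τ
        + gibbsAvg x (x p) h * gibbsAvg x (x q) h * gibbsCov x p q h * x q τ ^ 2
        - 1 / 2 * gibbsCov x p q h ^ 2 * x q τ ^ 2) * hp +
       (-gibbsAvg x (x q) h * gibbsCov x p q h * x p τ
        + gibbsAvg x (x p) h * gibbsAvg x (x q) h * gibbsCov x p q h
        - 1 / 2 * gibbsCov x p q h ^ 2) * hq)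
  have e2 : ∑ τ, convexityObs x a (fun p => x p τ * h p) * gibbsWeight x h τ =
      gibbsZ x h / 2 * ∑ q, a q * ∑ p, a p * gibbsCov x p q h ^ 2 := by
    rw [Finset.sum_congr rfl fun τ _ => e τ, Finset.sum_comm, Finset.mul_sum]
    refine Finset.sum_congr rfl fun q _ => ?_
    rw [← Finset.mul_sum, Finset.sum_comm, mul_left_comm]
    congr 1
    rw [Finset.mul_sum]
    refine Finset.sum_congr rfl fun p _ => ?_
    rw [← Finset.mul_sum, Finset.sum_add_distrib, Finset.sum_sub_distrib, Finset.sum_sub_distrib,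
      ← Finset.mul_sum, ← Finset.mul_sum, ← Finset.mul_sum, ← Finset.mul_sum,
      sum_mul_gibbsWeight (fun _ => (1 : ℝ)), sum_mul_gibbsWeight (fun c => x p c * x q c),
      sum_mul_gibbsWeight, sum_mul_gibbsWeight, gibbsAvg_const]
    simp only [gibbsCov]
    ring
  rw [e2]
  exact mul_nonneg (by have := gibbsZ_pos (x := x) h; positivity) (sum_gibbsCov_sq_nonneg a h)

theorem integral_convexityObs_nonneg [Group C] (hsq : ∀ p c, x p c ^ 2 = 1)
    (hmul : ∀ p c d, x p (c * d) = x p c * x p d) (a : P → ℝ) {t : P → ℝ} (ht : ∀ p, 0 ≤ t p) :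
    0 ≤ ∫ g, convexityObs x a (gaussField t g) ∂iidGaussian P := by
  have hc : Continuous (convexityObs x a) := by
    have h1 := continuous_gibbsAvg (x := x)
    have h2 := continuous_gibbsCov (x := x)
    refine continuous_finsetSum _ fun q _ => continuous_const.mul
      (continuous_finsetSum _ fun p _ => ?_)
    have := h1 (x p)
    have := h1 (x q)
    have := h2 p q
    fun_prop
  have hb (h : P → ℝ) : |convexityObs x a h| ≤ (2 * 2 + 2 * 1 * 2 + 1 / 2 * 2 ^ 2) *
      (∑ p, |a p|) * ∑ p, |a p| := by
    refine abs_sum_mul_le a _ fun q => abs_sum_mul_le a _ fun p => ?_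
    have h1 := abs_one_sub_gibbsAvg_le hsq p h
    have h2 := abs_gibbsCov_le hsq p q h
    have h3 := abs_gibbsAvg_coord_le hsq q h
    refine (abs_sub _ _).trans (add_le_add ((abs_sub _ _).trans (add_le_add ?_ ?_)) ?_)
    · rw [abs_mul]; gcongr
    · rw [abs_mul, abs_mul]; gcongr
    · rw [abs_mul, abs_pow, abs_of_pos (by norm_num : (0 : ℝ) < 1 / 2)]; gcongr
  exact integral_gaussField_nonneg hsq hc hb
    (sum_convexityObs_gauge_nonneg hsq hmul a) ht

/-- On the Nishimori line the free entropy is convex, and hence lies above its tangents. -/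
theorem freeEntropy_tangent_le [Group C] (hsq : ∀ p c, x p c ^ 2 = 1)
    (hmul : ∀ p c d, x p (c * d) = x p c * x p d) {u t : P → ℝ} (hu : ∀ p, 0 < u p)
    (ht : ∀ p, 0 ≤ t p) :
    freeEntropy x u + ∫ g, ∑ p, (t p - u p) * overlapObs x p (gaussField u g) ∂iidGaussian P ≤
      freeEntropy x t := by
  set a : P → ℝ := fun p => t p - u p with ha
  -- Strict positivity may fail at s = 1, where some `t p` can vanish; at that endpoint only
  -- continuity is used.
  have hpos (s : ℝ) (hs : s ∈ Set.Ico (0 : ℝ) 1) (p : P) : 0 < u p + s * a p := by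
    have h1 : 0 < (1 - s) * u p := mul_pos (by linarith [hs.2]) (hu p)
    have h2 : 0 ≤ s * t p := mul_nonneg hs.1 (ht p)
    simp only [ha]
    linarith
  have hconv : ConvexOn ℝ (Set.Icc 0 1)
      (fun s : ℝ => freeEntropy x (fun p => u p + s * a p)) := by
    have hl : 0 ≤ Real.log (Fintype.card C) :=
      Real.log_nonneg (by exact_mod_cast Fintype.card_pos)
    refine convexOn_of_hasDerivWithinAt2_nonneg (convex_Icc 0 1)
      (continuousOn_integral_gaussField hasGrad_log_gibbsZ.continuous (by positivity)
        (abs_log_gibbsZ_le hsq) u a)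
      (fun s hs => (hasDerivAt_freeEntropy hsq u a s ?_).hasDerivWithinAt)
      (fun s hs => (hasDerivAt_deriv_freeEntropy hsq u a s ?_).hasDerivWithinAt)
      (fun s hs => integral_convexityObs_nonneg hsq hmul a fun p => ?_)
    all_goals rw [interior_Icc] at hs
    · exact hpos s ⟨hs.1.le, hs.2⟩
    · exact hpos s ⟨hs.1.le, hs.2⟩
    · exact (hpos s ⟨hs.1.le, hs.2⟩ p).le
  have hd := hasDerivAt_freeEntropy hsq u a 0 (hpos 0 (by simp))
  have := hconv.le_slope_of_hasDerivAt (by simp) (by simp : (1 : ℝ) ∈ _) one_pos hd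
  rw [slope_def_field] at this
  simp only [zero_mul, add_zero, one_mul, sub_zero, div_one] at this
  have e : (fun p => u p + a p) = t := by funext p; simp [ha]
  rw [e] at this
  linarith

end

/-! ### Pair observables of Ising spins -/

theorem spinVal_sq (s : ℤˣ) : spinVal s ^ 2 = 1 := by
  rcases Int.units_eq_one_or s with h | h <;> simp [h, spinVal]

theorem spinVal_mul (s r : ℤˣ) : spinVal (s * r) = spinVal s * spinVal r := by
  simp [spinVal]

theorem spinVal_one : spinVal 1 = 1 := by simp [spinVal]

/-- The product of two spins. -/
def pairObs (S : Type*) (p : S × S) (σ : S → ℤˣ) : ℝ := spinVal (σ p.1) * spinVal (σ p.2)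

section Basic

variable {S : Type*}

theorem pairObs_sq (p : S × S) (σ : S → ℤˣ) : pairObs S p σ ^ 2 = 1 := by
  rw [pairObs, mul_pow, spinVal_sq, spinVal_sq, one_mul]

theorem pairObs_mul (p : S × S) (σ τ : S → ℤˣ) :
    pairObs S p (σ * τ) = pairObs S p σ * pairObs S p τ := by
  simp only [pairObs, Pi.mul_apply, spinVal_mul]
  ring

theorem pairObs_diag (i : S) (σ : S → ℤˣ) : pairObs S (i, i) σ = 1 := by
  rw [pairObs, ← sq, spinVal_sq]

theorem pairObs_one (p : S × S) : pairObs S p 1 = 1 := by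
  simp [pairObs, spinVal_one]

variable [Fintype S] [DecidableEq S]

/-- On the Nishimori line the averaged log-partition function is a free entropy. -/
theorem integral_log_partitionFn_eq_freeEntropy {β : ℝ} (hβ : 0 ≤ β) {mean : S → S → ℝ}
    {κ : S × S → ℝ} (hκ : ∀ p, 0 ≤ κ p) (hmean : ∀ p, κ p * mean p.1 p.2 = β * κ p ^ 2)
    {H : (S × S → ℝ) → (S → ℤˣ) → ℝ}
    (hH : ∀ J σ, H J σ = -∑ p, κ p * J p * pairObs S p σ) :
    ∫ J, Real.log (partitionFn β (H J)) ∂couplingLaw mean =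
      freeEntropy (pairObs S) (fun p => (β * κ p) ^ 2) := by
  have hZ (J : S × S → ℝ) : partitionFn β (H J) = gibbsZ (pairObs S) (fun p => β * κ p * J p) := by
    simp only [partitionFn, gibbsZ, gibbsWeight, hH]
    refine Finset.sum_congr rfl fun σ _ => ?_
    rw [neg_mul_neg, Finset.mul_sum]
    congr 1
    exact Finset.sum_congr rfl fun p _ => by ring
  simp_rw [hZ]
  have hc : Continuous fun J : S × S → ℝ =>
      Real.log (gibbsZ (pairObs S) (fun p => β * κ p * J p)) :=
    hasGrad_log_gibbsZ.continuous.comp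
      (f := fun (J : S × S → ℝ) p => β * κ p * J p) (by fun_prop)
  have h2 := integral_map (μ := iidGaussian (S × S)) (φ := fun g p => mean p.1 p.2 + g p)
    (f := fun J => Real.log (gibbsZ (pairObs S) (fun p => β * κ p * J p)))
    (measurable_pi_iff.2 fun p => (measurable_pi_apply p).const_add _).aemeasurable
    hc.aestronglyMeasurable
  rw [iidGaussian_map_add (fun p : S × S => mean p.1 p.2)] at h2
  rw [couplingLaw, h2, freeEntropy]
  congr 1
  funext g
  congr 2
  funext p
  rw [gaussField, Real.sqrt_sq (mul_nonneg hβ (hκ p)), mul_add, mul_assoc, hmean p]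
  ring

/-! ### Diagonal couplings -/

theorem integrable_gaussField_coord {P : Type*} [Fintype P] (t : P → ℝ) (p : P) :
    Integrable (fun g => gaussField t g p) (iidGaussian P) :=
  (integrable_const (t p)).add ((integrable_coord_iidGaussian p).const_mul _)

theorem integral_gaussField_coord {P : Type*} [Fintype P] (t : P → ℝ) (p : P) :
    ∫ g, gaussField t g p ∂iidGaussian P = t p := by
  simp only [gaussField]
  rw [integral_add (integrable_const _) ((integrable_coord_iidGaussian p).const_mul _),
    integral_const_mul, integral_coord_iidGaussian]
  simp

theorem integrable_log_gibbsZ {P C : Type*} [Fintype P] [Fintype C] [Nonempty C] {x : P → C → ℝ}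
    (hsq : ∀ p c, x p c ^ 2 = 1) (t : P → ℝ) :
    Integrable (fun g => Real.log (gibbsZ x (gaussField t g))) (iidGaussian P) := by
  have hl : 0 ≤ Real.log (Fintype.card C) :=
    Real.log_nonneg (by exact_mod_cast Fintype.card_pos)
  exact integrable_comp_gaussField hasGrad_log_gibbsZ.continuous (by positivity)
    (abs_log_gibbsZ_le hsq) t

theorem sum_diag_mul (h : S × S → ℝ) :
    ∑ p : S × S, (if p.1 = p.2 then h p else 0) = ∑ i, h (i, i) := by
  rw [Fintype.sum_prod_type]
  simp

/-- Diagonal couplings contribute additively to the free entropy. -/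
theorem freeEntropy_eq_offDiag_add (t : S × S → ℝ) :
    freeEntropy (pairObs S) t =
      freeEntropy (pairObs S) (fun p => if p.1 = p.2 then 0 else t p) + ∑ i, t (i, i) := by
  set t' : S × S → ℝ := fun p => if p.1 = p.2 then 0 else t p with ht'
  have hfield (g : S × S → ℝ) (p : S × S) : gaussField t g p =
      gaussField t' g p + if p.1 = p.2 then gaussField t g p else 0 := by
    by_cases h : p.1 = p.2 <;> simp [gaussField, ht', h]
  -- A diagonal pair observable is identically 1, so its field multiplies every weight by the same
  -- factor.
  have hZ (g : S × S → ℝ) : gibbsZ (pairObs S) (gaussField t g) =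
      gibbsZ (pairObs S) (gaussField t' g) * Real.exp (∑ i, gaussField t g (i, i)) := by
    rw [gibbsZ, gibbsZ, Finset.sum_mul]
    refine Finset.sum_congr rfl fun σ _ => ?_
    rw [gibbsWeight, gibbsWeight, ← Real.exp_add, ← sum_diag_mul, ← Finset.sum_add_distrib]
    congr 1
    refine Finset.sum_congr rfl fun p _ => ?_
    conv_lhs => rw [hfield g p]
    rw [add_mul]
    congr 1
    by_cases h : p.1 = p.2
    · obtain ⟨i, j⟩ := p
      obtain rfl : i = j := h
      rw [pairObs_diag, mul_one]
    · simp [h]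
  have hlog (g : S × S → ℝ) : Real.log (gibbsZ (pairObs S) (gaussField t g)) =
      Real.log (gibbsZ (pairObs S) (gaussField t' g)) + ∑ i, gaussField t g (i, i) := by
    rw [hZ, Real.log_mul (gibbsZ_ne_zero _) (Real.exp_pos _).ne', Real.log_exp]
  rw [freeEntropy]
  simp_rw [hlog]
  rw [integral_add (integrable_log_gibbsZ pairObs_sq t')
    (integrable_finsetSum _ fun i _ => integrable_gaussField_coord t (i, i)),
    integral_finsetSum _ fun i _ => integrable_gaussField_coord t (i, i)]
  simp only [integral_gaussField_coord, freeEntropy]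

/-- Keep only the all-plus configuration in Z; the expected exponent is the total strength. This
supplies the lower bound needed in Fekete's lemma. -/
theorem sum_le_freeEntropy (t : S × S → ℝ) : ∑ p, t p ≤ freeEntropy (pairObs S) t := by
  have e : ∑ p, t p = ∫ g, ∑ p, gaussField t g p ∂iidGaussian (S × S) := by
    rw [integral_finsetSum _ fun p _ => integrable_gaussField_coord t p]
    simp only [integral_gaussField_coord]
  rw [e]
  refine integral_mono (integrable_finsetSum _ fun p _ => integrable_gaussField_coord t p)
    (integrable_log_gibbsZ pairObs_sq t) fun g => ?_
  have h1 : gibbsWeight (pairObs S) (gaussField t g) 1 ≤ gibbsZ (pairObs S) (gaussField t g) :=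
    Finset.single_le_sum (fun σ _ => (gibbsWeight_pos _ σ).le) (Finset.mem_univ 1)
  have h2 := Real.log_le_log (gibbsWeight_pos _ _) h1
  rw [gibbsWeight, Real.log_exp] at h2
  simpa [pairObs_one] using h2

end Basic

/-! ### Site symmetries -/

section Reindex

variable {P Q C D : Type*} [Fintype P] [Fintype Q] [Fintype C] [Fintype D]

omit [Fintype C] [Fintype D] in
theorem gibbsWeight_reindex {x : P → C → ℝ} {y : Q → D → ℝ} (e : Q ≃ P) (f : D → C)
    (hxy : ∀ q d, y q d = x (e q) (f d)) (h : P → ℝ) (d : D) :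
    gibbsWeight y (fun q => h (e q)) d = gibbsWeight x h (f d) := by
  simp only [gibbsWeight, hxy]
  congr 1
  exact e.sum_comp fun p => h p * x p (f d)

theorem gibbsZ_reindex {x : P → C → ℝ} {y : Q → D → ℝ} (e : Q ≃ P) (f : D ≃ C)
    (hxy : ∀ q d, y q d = x (e q) (f d)) (h : P → ℝ) :
    gibbsZ y (fun q => h (e q)) = gibbsZ x h := by
  simp only [gibbsZ, gibbsWeight_reindex e f hxy]
  exact f.sum_comp (gibbsWeight x h)

theorem gibbsAvg_reindex {x : P → C → ℝ} {y : Q → D → ℝ} (e : Q ≃ P) (f : D ≃ C)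
    (hxy : ∀ q d, y q d = x (e q) (f d)) (h : P → ℝ) (q : Q) :
    gibbsAvg y (y q) (fun q => h (e q)) = gibbsAvg x (x (e q)) h := by
  simp only [gibbsAvg, gibbsZ_reindex e f hxy, gibbsWeight_reindex e f hxy, hxy]
  congr 1
  exact f.sum_comp fun c => x (e q) c * gibbsWeight x h c

theorem freeEntropy_reindex [Nonempty C] {x : P → C → ℝ} {y : Q → D → ℝ} (e : Q ≃ P) (f : D ≃ C)
    (hxy : ∀ q d, y q d = x (e q) (f d)) (t : P → ℝ) :
    freeEntropy y (fun q => t (e q)) = freeEntropy x t := by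
  have mp := measurePreserving_comp_iidGaussian e.injective
  have : Nonempty D := ⟨f.symm (Classical.arbitrary C)⟩
  have h := integral_map (μ := iidGaussian P) mp.measurable.aemeasurable
    (f := fun g => Real.log (gibbsZ y (gaussField (fun q => t (e q)) g)))
    ((hasGrad_log_gibbsZ.continuous.comp (continuous_gaussField _)).aestronglyMeasurable)
  rw [mp.map_eq] at h
  rw [freeEntropy, h, freeEntropy]
  congr 1
  funext g
  rw [← gibbsZ_reindex e f hxy (gaussField t g)]
  rfl

theorem integral_overlapObs_reindex [Nonempty C] {x : P → C → ℝ} {y : Q → D → ℝ} (e : Q ≃ P)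
    (f : D ≃ C) (hxy : ∀ q d, y q d = x (e q) (f d)) (t : P → ℝ) (q : Q) :
    ∫ g, overlapObs y q (gaussField (fun q => t (e q)) g) ∂iidGaussian Q =
      ∫ g, overlapObs x (e q) (gaussField t g) ∂iidGaussian P := by
  have mp := measurePreserving_comp_iidGaussian e.injective
  have : Nonempty D := ⟨f.symm (Classical.arbitrary C)⟩
  have h := integral_map (μ := iidGaussian P) mp.measurable.aemeasurable
    (f := fun g => overlapObs y q (gaussField (fun q => t (e q)) g))
    (((hasGrad_overlapObs q).continuous.comp (continuous_gaussField _)).aestronglyMeasurable)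
  rw [mp.map_eq] at h
  rw [h]
  congr 1
  funext g
  rw [overlapObs, overlapObs, ← gibbsAvg_reindex e f hxy (gaussField t g)]
  rfl

end Reindex

/-! ### Comparison with uniform couplings -/

section Comparison

variable {S : Type*} [Fintype S] [DecidableEq S]

omit [Fintype S] [DecidableEq S] in
theorem pairObs_reindex {T : Type*} (e : T ≃ S) (q : T × T) (σ : T → ℤˣ) :
    pairObs T q σ = pairObs S (e.prodCongr e q) (e.arrowCongr (Equiv.refl ℤˣ) σ) := by
  simp [pairObs]

omit [Fintype S] in
-- Two-transitivity of the symmetric group, by two transpositions; it makes the off-diagonal partial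
-- derivatives at a uniform point all equal.
theorem exists_perm_map_pair {i j k l : S} (hij : i ≠ j) (hkl : k ≠ l) :
    ∃ e : S ≃ S, e i = k ∧ e j = l := by
  refine ⟨(Equiv.swap i k).trans (Equiv.swap (Equiv.swap i k j) l), ?_, ?_⟩
  · rw [Equiv.trans_apply, Equiv.swap_apply_left]
    refine Equiv.swap_apply_of_ne_of_ne (fun h => hij ?_) hkl
    have : Equiv.swap i k i = Equiv.swap i k j := by rw [Equiv.swap_apply_left]; exact h
    exact (Equiv.swap i k).injective this
  · rw [Equiv.trans_apply, Equiv.swap_apply_left]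

theorem integrable_overlapObs (t : S × S → ℝ) (p : S × S) :
    Integrable (fun g => overlapObs (pairObs S) p (gaussField t g)) (iidGaussian (S × S)) :=
  Integrable.of_bound
    ((hasGrad_overlapObs p).continuous.comp (continuous_gaussField _)).aestronglyMeasurable 1
    (ae_of_all _ fun _ => overlapObs_abs_le pairObs_sq p _)

theorem integral_overlapObs_diag (t : S × S → ℝ) (i : S) :
    ∫ g, overlapObs (pairObs S) (i, i) (gaussField t g) ∂iidGaussian (S × S) = 1 := by
  have h1 : pairObs S (i, i) = fun _ => 1 := funext fun σ => pairObs_diag i σ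
  have h2 (h : S × S → ℝ) : overlapObs (pairObs S) (i, i) h = 1 := by
    rw [overlapObs, h1, gibbsAvg_const]; norm_num
  simp [h2]

/-- Among couplings with given total strength, the uniform ones minimize the free entropy on the
Nishimori line, up to a bounded diagonal correction. -/
theorem freeEntropy_uniform_le {c : ℝ} (hc : 0 < c) {t : S × S → ℝ} (ht : ∀ p, 0 ≤ t p)
    (hsum : ∑ p, t p = ∑ _p : S × S, c) :
    freeEntropy (pairObs S) (fun _ => c) - 2 * (Fintype.card S * c) ≤
      freeEntropy (pairObs S) t := by
  have key := freeEntropy_tangent_le (x := pairObs S) (u := fun _ => c) pairObs_sq pairObs_mul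
    (fun _ => hc) ht
  rw [integral_finsetSum _ fun p _ => (integrable_overlapObs _ p).const_mul _] at key
  simp only [integral_const_mul] at key
  set E : S × S → ℝ := fun p =>
    ∫ g, overlapObs (pairObs S) p (gaussField (fun _ => c) g) ∂iidGaussian (S × S) with hE
  have hEabs (p : S × S) : |E p| ≤ 1 := by
    have := norm_integral_le_of_norm_le_const (μ := iidGaussian (S × S)) (C := 1)
      (f := fun g => overlapObs (pairObs S) p (gaussField (fun _ => c) g))
      (ae_of_all _ fun _ => overlapObs_abs_le pairObs_sq p _)
    simpa using this
  have hEeq {i j k l : S} (hij : i ≠ j) (hkl : k ≠ l) : E (i, j) = E (k, l) := by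
    obtain ⟨e, rfl, rfl⟩ := exists_perm_map_pair hij hkl
    exact integral_overlapObs_reindex (e.prodCongr e) (e.arrowCongr (Equiv.refl ℤˣ))
      (pairObs_reindex e) (fun _ => c) (i, j)
  -- The common off-diagonal derivative; with at most one site there is no such pair and 0 serves as
  -- well.
  obtain ⟨q, hq, hqE⟩ : ∃ q : ℝ, |q| ≤ 1 ∧ ∀ i j : S, i ≠ j → E (i, j) = q := by
    by_cases h : ∃ i j : S, i ≠ j
    · obtain ⟨i, j, hij⟩ := h
      exact ⟨E (i, j), hEabs _, fun k l hkl => hEeq hkl hij⟩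
    · exact ⟨0, by simp, fun i j hij => absurd ⟨i, j, hij⟩ h⟩
  -- The constant `q` is split off from all pairs, where it multiplies a sum equal to zero; only the
  -- diagonal, whose derivative is 1, leaves a remainder.
  have hval (p : S × S) : (t p - c) * E p =
      q * (t p - c) + if p.1 = p.2 then (1 - q) * (t p - c) else 0 := by
    obtain ⟨i, j⟩ := p
    by_cases h : i = j
    · subst h
      have : E (i, i) = 1 := integral_overlapObs_diag _ i
      rw [this, if_pos rfl]; ring
    · rw [hqE i j h]; simp [h, mul_comm]
  have hsum0 : ∑ p, (t p - c) = 0 := by rw [Finset.sum_sub_distrib, hsum, sub_self]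
  have hlow : -(2 * (Fintype.card S * c)) ≤ ∑ p, (t p - c) * E p := by
    simp_rw [hval]
    rw [Finset.sum_add_distrib, ← Finset.mul_sum, hsum0, mul_zero, zero_add,
      sum_diag_mul fun p => (1 - q) * (t p - c)]
    -- Uses 0 ≤ 1 - q ≤ 2 and t (i, i) ≥ 0.
    have h2 : ∑ _i : S, -(2 * c) ≤ ∑ i : S, (1 - q) * (t (i, i) - c) := by
      refine Finset.sum_le_sum fun i _ => ?_
      have hq' := abs_le.1 hq
      have := ht (i, i)
      nlinarith [mul_nonneg (by linarith : 0 ≤ 1 - q) this]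
    refine le_trans (le_of_eq ?_) h2
    simp
    ring
  linarith

end Comparison

/-! ### Subadditivity of the mean-field free entropy -/

section Blocks

variable {A B : Type*} [Fintype A] [Fintype B] [DecidableEq A] [DecidableEq B]

/-- Couplings on `A ⊕ B` that do not couple the two blocks. -/
def blockCoupling (s : A × A → ℝ) (t : B × B → ℝ) : (A ⊕ B) × (A ⊕ B) → ℝ
  | (Sum.inl a, Sum.inl a') => s (a, a')
  | (Sum.inr b, Sum.inr b') => t (b, b')
  | _ => 0

omit [DecidableEq A] [DecidableEq B] in
theorem sum_blockCoupling (s : A × A → ℝ) (t : B × B → ℝ) :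
    ∑ p, blockCoupling s t p = ∑ p, s p + ∑ p, t p := by
  simp [Fintype.sum_prod_type, blockCoupling]

theorem gibbsZ_blockCoupling {h : (A ⊕ B) × (A ⊕ B) → ℝ} {s : A × A → ℝ} {t : B × B → ℝ}
    (hst : h = blockCoupling s t) :
    gibbsZ (pairObs (A ⊕ B)) h = gibbsZ (pairObs A) s * gibbsZ (pairObs B) t := by
  subst hst
  rw [gibbsZ, gibbsZ, gibbsZ, Finset.sum_mul_sum, ← Fintype.sum_prod_type',
    ← (Equiv.sumArrowEquivProdArrow A B ℤˣ).sum_comp]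
  refine Finset.sum_congr rfl fun σ _ => ?_
  rw [gibbsWeight, gibbsWeight, gibbsWeight, ← Real.exp_add]
  congr 1
  simp [Fintype.sum_prod_type, blockCoupling, pairObs, Equiv.sumArrowEquivProdArrow]

/-- Z factorizes over the two blocks, and each factor depends on a subfamily of the Gaussians that
is again standard. -/
theorem freeEntropy_blockCoupling (s : A × A → ℝ) (t : B × B → ℝ) :
    freeEntropy (pairObs (A ⊕ B)) (blockCoupling s t) =
      freeEntropy (pairObs A) s + freeEntropy (pairObs B) t := by
  have mpA := measurePreserving_comp_iidGaussian (P := (A ⊕ B) × (A ⊕ B))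
    (e := fun p : A × A => (Sum.inl p.1, Sum.inl p.2))
    fun p q h => by simpa [Prod.ext_iff] using h
  have mpB := measurePreserving_comp_iidGaussian (P := (A ⊕ B) × (A ⊕ B))
    (e := fun p : B × B => (Sum.inr p.1, Sum.inr p.2))
    fun p q h => by simpa [Prod.ext_iff] using h
  have hfield (g : (A ⊕ B) × (A ⊕ B) → ℝ) : gaussField (blockCoupling s t) g =
      blockCoupling (gaussField s fun p => g (Sum.inl p.1, Sum.inl p.2))
        (gaussField t fun p => g (Sum.inr p.1, Sum.inr p.2)) := by
    funext ⟨i, j⟩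
    rcases i with i | i <;> rcases j with j | j <;> simp [gaussField, blockCoupling]
  have hlog (g : (A ⊕ B) × (A ⊕ B) → ℝ) :
      Real.log (gibbsZ (pairObs (A ⊕ B)) (gaussField (blockCoupling s t) g)) =
      Real.log (gibbsZ (pairObs A) (gaussField s fun p => g (Sum.inl p.1, Sum.inl p.2))) +
      Real.log (gibbsZ (pairObs B) (gaussField t fun p => g (Sum.inr p.1, Sum.inr p.2))) := by
    rw [gibbsZ_blockCoupling (hfield g), Real.log_mul (gibbsZ_ne_zero _) (gibbsZ_ne_zero _)]
  have hA := integrable_log_gibbsZ (x := pairObs A) pairObs_sq s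
  have hB := integrable_log_gibbsZ (x := pairObs B) pairObs_sq t
  have iA := integral_map mpA.measurable.aemeasurable (by rw [mpA.map_eq]; exact hA.1)
  have iB := integral_map mpB.measurable.aemeasurable (by rw [mpB.map_eq]; exact hB.1)
  rw [mpA.map_eq] at iA
  rw [mpB.map_eq] at iB
  rw [freeEntropy, freeEntropy, freeEntropy, iA, iB]
  simp_rw [hlog]
  exact integral_add (mpA.integrable_comp_of_integrable hA) (mpB.integrable_comp_of_integrable hB)

end Blocks

/-- The free entropy of the mean-field model with all ordered pairs coupled, on the Nishimori
line. -/
def meanFieldEntropy (β : ℝ) (N : ℕ) : ℝ :=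
  freeEntropy (pairObs (Fin N)) (fun _ => β ^ 2 / (2 * N))

theorem freeEntropy_uniform_eq (β : ℝ) (S : Type*) [Fintype S] [DecidableEq S] :
    freeEntropy (pairObs S) (fun _ => β ^ 2 / (2 * Fintype.card S)) =
      meanFieldEntropy β (Fintype.card S) := by
  have e := Fintype.equivFin S
  exact freeEntropy_reindex (e.prodCongr e) (e.arrowCongr (Equiv.refl ℤˣ)) (pairObs_reindex e)
    (fun _ => β ^ 2 / (2 * (Fintype.card S : ℝ)))

theorem sum_uniform (β : ℝ) (S : Type*) [Fintype S] :
    ∑ _p : S × S, β ^ 2 / (2 * (Fintype.card S : ℝ)) = Fintype.card S * (β ^ 2 / 2) := by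
  rw [Finset.sum_const, Finset.card_univ, Fintype.card_prod, nsmul_eq_mul]
  push_cast
  rcases eq_or_ne (Fintype.card S : ℝ) 0 with h | h
  · simp [h]
  · field_simp

/-- The prescribed total is that of the uniform strength c = β²/(2|S|), and the diagonal error 2|S|c
equals β² whatever the size of S. -/
theorem meanFieldEntropy_le {β : ℝ} (hβ : 0 < β) {S : Type*} [Fintype S] [DecidableEq S]
    {t : S × S → ℝ} (ht : ∀ p, 0 ≤ t p) (hsum : ∑ p, t p = Fintype.card S * (β ^ 2 / 2))
    (hS : 0 < Fintype.card S) :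
    meanFieldEntropy β (Fintype.card S) ≤ freeEntropy (pairObs S) t + β ^ 2 := by
  have hS' : (0 : ℝ) < Fintype.card S := by exact_mod_cast hS
  have := freeEntropy_uniform_le (c := β ^ 2 / (2 * Fintype.card S)) (by positivity) ht
    (by rw [hsum, sum_uniform])
  rw [freeEntropy_uniform_eq] at this
  have e : 2 * ((Fintype.card S : ℝ) * (β ^ 2 / (2 * Fintype.card S))) = β ^ 2 := by
    field_simp
  linarith

theorem meanFieldEntropy_nonneg (β : ℝ) (N : ℕ) : 0 ≤ meanFieldEntropy β N :=
  (Finset.sum_nonneg fun _ _ => by positivity).trans (sum_le_freeEntropy _)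

/-- Two decoupled mean-field blocks have total strength Mβ²/2 + Nβ²/2, the same as the joint
mean-field model. Adding β² to the entropy absorbs the error of the comparison. -/
theorem subadditive_meanFieldEntropy {β : ℝ} (hβ : 0 < β) :
    Subadditive fun N => meanFieldEntropy β N + β ^ 2 := by
  intro M N
  have hM := meanFieldEntropy_nonneg β M
  have hN := meanFieldEntropy_nonneg β N
  -- The comparison needs a site; for M = N = 0 nonnegativity suffices.
  rcases Nat.eq_zero_or_pos (M + N) with h0 | hpos
  · obtain ⟨rfl, rfl⟩ := Nat.add_eq_zero_iff.1 h0
    simp only [add_zero]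
    nlinarith
  · have key := meanFieldEntropy_le hβ (S := Fin M ⊕ Fin N)
      (t := blockCoupling (fun _ => β ^ 2 / (2 * M)) (fun _ => β ^ 2 / (2 * N)))
      (fun p => by
        obtain ⟨i, j⟩ := p
        rcases i with i | i <;> rcases j with j | j <;> simp only [blockCoupling] <;> positivity)
      (by
        have h1 := sum_uniform β (Fin M)
        have h2 := sum_uniform β (Fin N)
        rw [Fintype.card_fin] at h1 h2
        rw [sum_blockCoupling, h1, h2, Fintype.card_sum, Fintype.card_fin, Fintype.card_fin]
        push_cast
        ring)
      (by simpa using hpos)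
    rw [freeEntropy_blockCoupling, Fintype.card_sum, Fintype.card_fin, Fintype.card_fin] at key
    change meanFieldEntropy β (M + N) ≤ meanFieldEntropy β M + meanFieldEntropy β N + β ^ 2 at key
    change meanFieldEntropy β (M + N) + β ^ 2 ≤
      meanFieldEntropy β M + β ^ 2 + (meanFieldEntropy β N + β ^ 2)
    linarith

theorem exists_tendsto_meanFieldEntropy {β : ℝ} (hβ : 0 < β) :
    ∃ l : ℝ, Tendsto (fun N : ℕ => meanFieldEntropy β N / N) atTop (𝓝 l) := by
  have hsub := subadditive_meanFieldEntropy hβ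
  have hlim := hsub.tendsto_lim ⟨0, by
    rintro _ ⟨N, rfl⟩
    have := meanFieldEntropy_nonneg β N
    positivity⟩
  refine ⟨hsub.lim, ?_⟩
  have h2 := hlim.sub (tendsto_const_div_atTop_nhds_zero_nat (β ^ 2))
  rw [sub_zero] at h2
  refine h2.congr fun N => ?_
  rw [← sub_div, add_sub_cancel_right]

/-! ### The Sherrington–Kirkpatrick model -/

/-- SK is the mean-field model without diagonal couplings, and these contribute N · β²/(2N) = β²/2
to the entropy. -/
theorem skFreeEnergy_eq {β : ℝ} (hβ : 0 < β) {N : ℕ} (hN : 0 < N) :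
    skFreeEnergy N β = -(1 / β) * (meanFieldEntropy β N / N - β ^ 2 / 2 / N) := by
  have hN' : (0 : ℝ) < N := by exact_mod_cast hN
  set κ : Fin N × Fin N → ℝ := fun p => if p.1 = p.2 then 0 else 1 / √(2 * (N : ℝ)) with hκ
  have hint : ∫ J, Real.log (partitionFn β (skHamiltonian N J)) ∂(skNishimoriLaw N β) =
      freeEntropy (pairObs (Fin N)) (fun p => (β * κ p) ^ 2) := by
    refine integral_log_partitionFn_eq_freeEntropy hβ.le (fun p => ?_) (fun p => ?_) fun J σ => ?_
    · by_cases h : p.1 = p.2 <;> simp [hκ, h]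
    · by_cases h : p.1 = p.2
      · simp [hκ, h]
      · simp only [hκ, if_neg h]; ring
    · rw [skHamiltonian, neg_mul, Finset.mul_sum, Fintype.sum_prod_type]
      congr 1
      refine Finset.sum_congr rfl fun i _ => ?_
      rw [Finset.mul_sum]
      refine Finset.sum_congr rfl fun j _ => ?_
      by_cases h : i = j
      · simp [hκ, h]
      · simp only [hκ, h, pairObs, ne_eq, not_false_eq_true, if_true, if_false]; ring
  have hdiag := freeEntropy_eq_offDiag_add (S := Fin N) (fun _ => β ^ 2 / (2 * N))
  have hκsq : (fun p => (β * κ p) ^ 2) =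
      fun p : Fin N × Fin N => if p.1 = p.2 then 0 else β ^ 2 / (2 * N) := by
    funext p
    by_cases h : p.1 = p.2
    · simp [hκ, h]
    · simp only [hκ, if_neg h]
      rw [mul_pow, div_pow, Real.sq_sqrt (by positivity), one_pow, mul_one_div]
  have hs : ∑ _i : Fin N, β ^ 2 / (2 * (N : ℝ)) = β ^ 2 / 2 := by
    rw [Finset.sum_const, Finset.card_univ, Fintype.card_fin, nsmul_eq_mul]
    field_simp
  rw [hs] at hdiag
  rw [skFreeEnergy, hint, hκsq, meanFieldEntropy, hdiag]
  field_simp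
  ring

/-! ### The Kac model -/

section Kac

variable {d L : ℕ} {φ : EuclideanSpace ℝ (Fin d) → ℝ} {γ : ℝ}

theorem kacSum_nonneg (hφ : ∀ x, 0 ≤ φ x) (hγ : 0 ≤ γ) : 0 ≤ kacSum φ L γ :=
  Finset.sum_nonneg fun _ _ => mul_nonneg (pow_nonneg hγ d) (hφ _)

theorem kacPotential_nonneg (hφ : ∀ x, 0 ≤ φ x) (hγ : 0 ≤ γ) (r : EuclideanSpace ℝ (Fin d)) :
    0 ≤ kacPotential φ L γ r :=
  div_nonneg (mul_nonneg (pow_nonneg hγ d) (hφ _)) (kacSum_nonneg hφ hγ)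

/-- Subtraction in `Fin L` is modulo L, which the reduction to [-L/2, L/2) does not see; the
relative position is thus translation invariant on the torus. -/
theorem relPos_eq_minImage_sub [NeZero L] (i j : Site d L) :
    relPos i j = minImage L fun k => (((i - j) k : Fin L) : ℤ) := by
  simp only [relPos, minImage, Pi.sub_apply, Fin.coe_int_sub_eq_mod, Int.emod_bmod]

theorem sum_kacPotential_relPos [NeZero L] (h : kacSum φ L γ ≠ 0) (j : Site d L) :
    ∑ i : Site d L, kacPotential φ L γ (relPos i j) = 1 := by
  simp only [relPos_eq_minImage_sub, kacPotential]
  refine ((Equiv.subRight j).sum_comp (fun i : Site d L =>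
    γ ^ d * φ (γ • minImage L fun k => ((i k : Fin L) : ℤ)) / kacSum φ L γ)).trans ?_
  rw [← Finset.sum_div]
  exact div_self h

/-- The Kac strengths are β²K/2, and every column of K sums to one, so their total is that of the
mean-field model on L^d sites and the comparison applies. -/
theorem kacFreeEnergy_le {β : ℝ} (hβ : 0 < β) (hφ : ∀ x, 0 ≤ φ x) (hγ : 0 ≤ γ)
    (hsum : kacSum φ L γ ≠ 0) (hL : 0 < L) :
    kacFreeEnergy φ L γ β ≤
      -(1 / β) * (meanFieldEntropy β (L ^ d) / (L ^ d : ℕ) - β ^ 2 / (L ^ d : ℕ)) := by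
  have : NeZero L := ⟨hL.ne'⟩
  have hcard : Fintype.card (Site d L) = L ^ d := by simp
  have hK (r : EuclideanSpace ℝ (Fin d)) : 0 ≤ kacPotential φ L γ r / 2 :=
    div_nonneg (kacPotential_nonneg hφ hγ r) two_pos.le
  set κ : Site d L × Site d L → ℝ := fun p => √(kacPotential φ L γ (relPos p.1 p.2) / 2) with hκ
  have hint : ∫ J, Real.log (partitionFn β (kacHamiltonian φ L γ J)) ∂(kacNishimoriLaw φ L γ β) =
      freeEntropy (pairObs (Site d L)) (fun p => (β * κ p) ^ 2) := by
    refine integral_log_partitionFn_eq_freeEntropy hβ.le (fun p => Real.sqrt_nonneg _)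
      (fun p => by ring) fun J σ => ?_
    rw [kacHamiltonian, Fintype.sum_prod_type]
    simp only [pairObs, mul_assoc]
  have hκsum : ∑ p, (β * κ p) ^ 2 = Fintype.card (Site d L) * (β ^ 2 / 2) := by
    have e (p : Site d L × Site d L) : (β * κ p) ^ 2 =
        β ^ 2 / 2 * kacPotential φ L γ (relPos p.1 p.2) := by
      rw [mul_pow, Real.sq_sqrt (hK _)]; ring
    simp_rw [e]
    rw [← Finset.mul_sum, Fintype.sum_prod_type_right]
    simp only [sum_kacPotential_relPos hsum]
    simp
    ring
  have key := meanFieldEntropy_le hβ (fun p => sq_nonneg (β * κ p)) hκsum Fintype.card_pos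
  rw [hcard] at key
  have hLd : (0 : ℝ) < (L : ℝ) ^ d := by positivity
  rw [kacFreeEnergy, hint, neg_mul, neg_mul, neg_le_neg_iff]
  push_cast
  rw [← sub_div, ← mul_div_assoc, one_div_mul_eq_div, one_div_mul_eq_div, div_div]
  gcongr
  linarith

end Kac

/-! ### Passage to the limit -/

theorem lemma2 (β : ℝ) (hβ : 0 < β) :
    ∃ fSK : ℝ,
      Tendsto (fun N : ℕ => skFreeEnergy N β) atTop (𝓝 fSK) ∧
      ∀ (d : ℕ), 1 ≤ d →
        ∀ φ : EuclideanSpace ℝ (Fin d) → ℝ, (∀ x, 0 ≤ φ x) →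
          (∀ᶠ L : ℕ in atTop, kacSum φ L (1 / (L : ℝ)) ≠ 0) →
          ∀ f : ℝ,
            Tendsto (fun L : ℕ => kacFreeEnergy φ L (1 / (L : ℝ)) β) atTop (𝓝 f) →
            f ≤ fSK := by
  obtain ⟨l, hl⟩ := exists_tendsto_meanFieldEntropy hβ
  have hlim (b : ℝ) : Tendsto (fun N : ℕ => -(1 / β) * (meanFieldEntropy β N / N - b / N)) atTop
      (𝓝 (-(1 / β) * l)) := by
    have := (hl.sub (tendsto_const_div_atTop_nhds_zero_nat b)).const_mul (-(1 / β))
    rwa [sub_zero] at this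
  refine ⟨-(1 / β) * l, (hlim (β ^ 2 / 2)).congr' ?_, fun d hd φ hφ hsum f hf => ?_⟩
  · filter_upwards [eventually_gt_atTop 0] with N hN
    exact (skFreeEnergy_eq hβ hN).symm
  -- The Kac bound involves the mean-field entropy along N = L^d, a sequence tending to infinity
  -- because d ≥ 1, so it has the same limit as SK.
  · have hpow : Tendsto (fun L : ℕ => L ^ d) atTop atTop :=
      tendsto_pow_atTop (Nat.one_le_iff_ne_zero.1 hd)
    refine le_of_tendsto_of_tendsto hf ((hlim (β ^ 2)).comp hpow) ?_
    filter_upwards [hsum, eventually_gt_atTop 0] with L hL hLpos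
    exact kacFreeEnergy_le hβ hφ (by positivity) hL hLpos

end
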